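/- Let $K$ be a field. An integer poset of size $n$ is a reflexive, transitive, antisymmetric relation on $[n]=\{1,\dots,n\}$; let $\mathrm{IPos}_n$ be the set of these, $\mathrm{IPos}=\bigsqcup_{n\ge 0}\mathrm{IPos}_n$, and $K\,\mathrm{IPos}$ the $K$-vector space with basis $(F_P)_{P\in\mathrm{IPos}}$. The weak order on reflexive relations on $[n]$ is: $R\preccurlyeq S$ iff $\{(a,b)\in R: a\le b\}\supseteq\{(a,b)\in S: a\le b\}$ and $\{(b,a)\in R: a\le b\}\subseteq\{(b,a)\in S: a\le b\}$. For reflexive relations $R$ on $[m]$ and $S$ on $[n]$, let $\overline{S}$ and $\overline{[n]}$ denote $S$ and $[n]$ shifted by $m$. The shifted shuffle $R\,\overline{\sqcup\!\sqcup}\,S$ is the set of relations $R\sqcup\overline S\sqcup I\sqcup D$ with $I\subseteq[m]\times\overline{[n]}$ and $D\subseteq\overline{[n]}\times[m]$. Put $\underline{RS}=R\cup\overline S\cup([m]\times\overline{[n]})$ and $\overline{RS}=R\cup\overline S\cup(\overline{[n]}\times[m])$. A total cut of a relation $T$ on $[p]$ is a partition $[p]=X\sqcup Y$ with $x\,T\,y$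 and not $y\,T\,x$ for all $x\in X$, $y\in Y$. The convolution $R*S$ is the set of reflexive relations $T$ on $[m+n]$ having a total cut $(X,Y)$ such that the standardized restrictions satisfy $T_X=R$ and $T_Y=S$. Equip $K\,\mathrm{IPos}$ with $$F_P\cdot F_Q=\sum_{T\in (P\,\overline{\sqcup\!\sqcup}\,Q)\cap\mathrm{IPos}}F_T,\qquad \Delta(F_T)=\sum_{P,Q\in\mathrm{IPos},\ T\in P*Q}F_P\otimes F_Q,$$ with unit $F_\varnothing$ and counit sending $F_\varnothing$ to $1$ and every other $F_P$ to $0$. For a permutation $\sigma$ of $[n]$ let $\prec_\sigma$ be the chain $\sigma(1)\prec\dots\prec\sigma(n)$, and order permutations by the weak order: $\sigma\le\tau$ iff every inversion of $\sigma$ (pair of values $a<b$ with $b$ before $a$) is one of $\tau$. Let $\mathrm{WOIP}_n$ (weak order interval posets) be the set of posets $\bigcap_{\sigma\le\tau\le\sigma'}\prec_\tau$ with $\sigma\le\sigma'$, and let $\mathrm{IWOIP}_n$ (resp. $\mathrm{DWOIP}_n$) be the set of posets on $[n]$ whose set of linear extensions has a maximum (resp. minimum) for the weak order; $\mathrm{WOIP}$,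 $\mathrm{IWOIP}$, $\mathrm{DWOIP}$ are the disjoint unions over $n\ge0$. **Proposition.** $(K\,\mathrm{IPos},\cdot,\Delta)$ is a Hopf algebra, and for each of the families $C=\mathrm{WOIP},\ \mathrm{IWOIP},\ \mathrm{DWOIP}$: 1. for $P,Q\in\mathrm{IPos}$, if $(P\,\overline{\sqcup\!\sqcup}\,Q)\cap C\neq\varnothing$, then $P\in C$ and $Q\in C$; 2. if $P,Q\in C$, then $P*Q\subseteq C$; 3. the span $J_C$ of $\{F_P: P\in\mathrm{IPos}\setminus C\}$ is a Hopf ideal of $K\,\mathrm{IPos}$ (a two-sided ideal and coideal stable under the antipode); 4. consequently $K\,\mathrm{IPos}/J_C$ is a Hopf algebra for the induced operations, with basis the classes $[F_P]$, $P\in C$; 5. for $P\in C_m$ and $Q\in C_n$, the posets $\underline{PQ}$ and $\overline{PQ}$ belong to $C_{m+n}$, and $[F_P]\cdot[F_Q]=\sum[F_T]$, where $T$ runs over the interval between $\underline{PQ}$ and $\overline{PQ}$ in the weak order on $C_{m+n}$. -/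

import Mathlib

open scoped TensorProduct

noncomputable section

namespace IntegerPosets

/-! ### Integer relations and integer posets

The ground set `[n] = {1, …, n}` is represented by the linear order `Fin n`. -/

/-- Reflexive binary relations on `[n]`. -/
abbrev IRel (n : ℕ) : Type :=
  {r : Fin n → Fin n → Prop // ∀ x, r x x}

/-- A (reflexive) integer relation is an integer poset if it is transitive and antisymmetric. -/
def IRel.IsPoset {n : ℕ} (R : IRel n) : Prop :=
  (∀ x y z, R.1 x y → R.1 y z → R.1 x z) ∧ (∀ x y, R.1 x y → R.1 y x → x = y)

/-- Integer posets on `[n]`. -/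
abbrev IPos (n : ℕ) : Type :=
  {R : IRel n // R.IsPoset}

/-- The weak order on integer relations: the increasing part of `R` contains that of `S` and the
decreasing part of `R` is contained in that of `S`. -/
def WeakLE {n : ℕ} (R S : IRel n) : Prop :=
  (∀ a b, a ≤ b → S.1 a b → R.1 a b) ∧ (∀ a b, a ≤ b → R.1 b a → S.1 b a)

/-! ### Shifted shuffle -/

/-- The relation `R ⊔ S̄ ⊔ I ⊔ D` on `[m + n]`, where `S̄` is `S` shifted by `m`, `I` consists of
pairs in `[m] × {m+1, …, m+n}` and `D` of pairs in `{m+1, …, m+n} × [m]`. -/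
def block {m n : ℕ} (R : IRel m) (S : IRel n)
    (I : Fin m → Fin n → Prop) (D : Fin n → Fin m → Prop) : IRel (m + n) :=
  ⟨fun u v =>
    match finSumFinEquiv.symm u, finSumFinEquiv.symm v with
    | Sum.inl a, Sum.inl b => R.1 a b
    | Sum.inl a, Sum.inr b => I a b
    | Sum.inr a, Sum.inl b => D a b
    | Sum.inr a, Sum.inr b => S.1 a b,
  by
    intro x
    rcases h : finSumFinEquiv.symm x with a | a
    · simpa [h] using R.2 a
    · simpa [h] using S.2 a⟩

/-- The shifted shuffle of `R` and `S`. -/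
def shiftedShuffle {m n : ℕ} (R : IRel m) (S : IRel n) : Set (IRel (m + n)) :=
  {T | ∃ I D, T = block R S I D}

/-- `R ∪ S̄ ∪ ([m] × {m+1, …, m+n})`. -/
def underProd {m n : ℕ} (R : IRel m) (S : IRel n) : IRel (m + n) :=
  block R S (fun _ _ => True) (fun _ _ => False)

/-- `R ∪ S̄ ∪ ({m+1, …, m+n} × [m])`. -/
def overProd {m n : ℕ} (R : IRel m) (S : IRel n) : IRel (m + n) :=
  block R S (fun _ _ => False) (fun _ _ => True)

/-! ### Convolution -/

/-- The standardized restriction of `T` to `X = {x₁ < … < x_k}`. -/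
def restrict {p k : ℕ} (T : IRel p) (X : Finset (Fin p)) (hX : X.card = k) : IRel k :=
  ⟨fun i j => T.1 (X.orderEmbOfFin hX i) (X.orderEmbOfFin hX j), fun _ => T.2 _⟩

/-- `(X, Y)` is a total cut of `T`. -/
def IsTotalCut {p : ℕ} (T : IRel p) (X Y : Finset (Fin p)) : Prop :=
  IsCompl X Y ∧ ∀ x ∈ X, ∀ y ∈ Y, T.1 x y ∧ ¬ T.1 y x

/-- The convolution of `R` and `S`, as a set of relations on `[p]`; it is empty unless
`p = m + n`. -/
def convolution {m n : ℕ} (p : ℕ) (R : IRel m) (S : IRel n) : Set (IRel p) :=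
  {T | ∃ (X Y : Finset (Fin p)) (hX : X.card = m) (hY : Y.card = n),
    IsTotalCut T X Y ∧ restrict T X hX = R ∧ restrict T Y hY = S}

/-! ### Permutations and the families `WOIP`, `IWOIP`, `DWOIP` -/

/-- The chain `σ(1) ≺ σ(2) ≺ … ≺ σ(n)` attached to a permutation `σ`. -/
def chain {n : ℕ} (σ : Equiv.Perm (Fin n)) (u v : Fin n) : Prop :=
  σ.symm u ≤ σ.symm v

/-- The inversion set of `σ`: pairs of values `a < b` such that `b` appears before `a`. -/
def invSet {n : ℕ} (σ : Equiv.Perm (Fin n)) : Set (Fin n × Fin n) :=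
  {ab | ab.1 < ab.2 ∧ σ.symm ab.2 < σ.symm ab.1}

/-- The weak order on permutations. -/
def PermLE {n : ℕ} (σ τ : Equiv.Perm (Fin n)) : Prop :=
  invSet σ ⊆ invSet τ

/-- Weak order interval posets: the intersections of the chains of all the permutations in a
nonempty interval `[σ, σ']` of the weak order. -/
def WOIP (n : ℕ) : Set (IPos n) :=
  {P | ∃ σ σ' : Equiv.Perm (Fin n), PermLE σ σ' ∧
    ∀ u v, P.1.1 u v ↔ ∀ τ, PermLE σ τ → PermLE τ σ' → chain τ u v}

/-- The permutation `τ` is a linear extension of `P`. -/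
def IsLinExt {n : ℕ} (P : IPos n) (τ : Equiv.Perm (Fin n)) : Prop :=
  ∀ u v, P.1.1 u v → chain τ u v

/-- Posets with a maximum linear extension for the weak order. -/
def IWOIP (n : ℕ) : Set (IPos n) :=
  {P | ∃ τ, IsLinExt P τ ∧ ∀ ρ, IsLinExt P ρ → PermLE ρ τ}

/-- Posets with a minimum linear extension for the weak order. -/
def DWOIP (n : ℕ) : Set (IPos n) :=
  {P | ∃ τ, IsLinExt P τ ∧ ∀ ρ, IsLinExt P ρ → PermLE τ ρ}

/-! ### Hopf algebras, Hopf ideals -/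

section Hopf

universe u v w

/-- A product, unit, coproduct and counit on a vector space (data only). -/
structure Ops (K : Type u) (V : Type v) [Field K] [AddCommGroup V] [Module K V] where
  mul : V →ₗ[K] V →ₗ[K] V
  one : V
  comul : V →ₗ[K] V ⊗[K] V
  counit : V →ₗ[K] K

variable {K : Type u} {V : Type v} {W : Type w} [Field K]
  [AddCommGroup V] [Module K V] [AddCommGroup W] [Module K W]

/-- The operations `O` make `V` a Hopf algebra with antipode `S`: along some linear isomorphism
they are the operations of a Hopf algebra in the sense of Mathlib. -/
def Ops.IsHopfAlgebra (O : Ops K V) (S : V →ₗ[K] V) : Prop :=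
  ∃ (H : Type v) (_ : Ring H) (_ : HopfAlgebra K H) (e : V ≃ₗ[K] H),
    (∀ x y, e (O.mul x y) = e x * e y) ∧
    e O.one = 1 ∧
    (∀ x, Coalgebra.comul (R := K) (e x)
      = TensorProduct.map e.toLinearMap e.toLinearMap (O.comul x)) ∧
    (∀ x, Coalgebra.counit (R := K) (e x) = O.counit x) ∧
    (∀ x, HopfAlgebra.antipode K (e x) = e (S x))

/-- `I` is a Hopf ideal: a two-sided ideal and a coideal, stable under the antipode `S`. -/
structure Ops.IsHopfIdeal (O : Ops K V) (S : V →ₗ[K] V) (I : Submodule K V) : Prop where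
  mul_mem_left : ∀ x, ∀ y ∈ I, O.mul x y ∈ I
  mul_mem_right : ∀ x ∈ I, ∀ y, O.mul x y ∈ I
  comul_mem : ∀ x ∈ I, O.comul x ∈
    LinearMap.range (TensorProduct.map I.subtype (LinearMap.id : V →ₗ[K] V)) ⊔
      LinearMap.range (TensorProduct.map (LinearMap.id : V →ₗ[K] V) I.subtype)
  counit_eq_zero : ∀ x ∈ I, O.counit x = 0
  antipode_mem : ∀ x ∈ I, S x ∈ I

/-- `f` is compatible with products, units, coproducts and counits. -/
structure Ops.IsHom (O : Ops K V) (O₂ : Ops K W) (f : V →ₗ[K] W) : Prop where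
  map_mul : ∀ x y, f (O.mul x y) = O₂.mul (f x) (f y)
  map_one : f O.one = O₂.one
  map_comul : ∀ x, TensorProduct.map f f (O.comul x) = O₂.comul (f x)
  map_counit : ∀ x, O₂.counit (f x) = O.counit x

/-! ### The integer poset algebra -/

variable (K)

/-- The vector space with basis indexed by the integer posets of all sizes. -/
abbrev KIPos : Type u := (Σ n, IPos n) →₀ K

/-- The standard basis of `KIPos K`. -/
def F {n : ℕ} (P : IPos n) : KIPos K := Finsupp.single ⟨n, P⟩ 1

/-- The empty poset. -/
def emptyPos : IPos 0 := ⟨⟨fun _ _ => True, fun _ => trivial⟩, fun x => x.elim0, fun x => x.elim0⟩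

open Classical in
/-- The product of two basis elements: the sum over the posets in the shifted shuffle. -/
def basisMul {m n : ℕ} (P : IPos m) (Q : IPos n) : KIPos K :=
  ∑ T : IPos (m + n) with T.1 ∈ shiftedShuffle P.1 Q.1, F K T

open Classical in
/-- The coproduct of a basis element `T`: the sum over all the pairs of posets `P`, `Q` such that
`T` is in the convolution of `P` and `Q`. -/
def basisComul {p : ℕ} (T : IPos p) : KIPos K ⊗[K] KIPos K :=
  ∑ mn ∈ Finset.HasAntidiagonal.antidiagonal p,
    ∑ PQ : IPos mn.1 × IPos mn.2 with T.1 ∈ convolution p PQ.1.1 PQ.2.1,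
      F K PQ.1 ⊗ₜ[K] F K PQ.2

/-- The integer poset algebra. -/
def posOps : Ops K (KIPos K) where
  mul := Finsupp.lift (KIPos K →ₗ[K] KIPos K) K (Σ n, IPos n) fun P =>
    Finsupp.lift (KIPos K) K (Σ n, IPos n) fun Q => basisMul K P.2 Q.2
  one := F K emptyPos
  comul := Finsupp.lift (KIPos K ⊗[K] KIPos K) K (Σ n, IPos n) fun T => basisComul K T.2
  counit := Finsupp.lift K K (Σ n, IPos n) fun T => if T.1 = 0 then 1 else 0

/-- The subspace spanned by the posets which are not in the family `C`. -/
def complSpan (C : ∀ n, Set (IPos n)) : Submodule K (KIPos K) :=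
  Submodule.span K {x | ∃ (n : ℕ) (P : IPos n), P ∉ C n ∧ x = F K P}

/-- The class, modulo the posets which are not in `C`, of the basis element of `P`. -/
def FQuo (C : ∀ n, Set (IPos n)) {n : ℕ} (P : IPos n) : KIPos K ⧸ complSpan K C :=
  (complSpan K C).mkQ (F K P)

end Hopf

end IntegerPosets

end

/-! The bialgebra axioms reduce to statements about restrictions of a poset. A product `F P · F Q`
sums the posets whose restrictions to the first and last blocks are `P` and `Q`
(`mem_shiftedShuffle_iff`); a coproduct sums over the subsets `X` lying entirely below their
complement (`comul_F`). Associativity and coassociativity compare sums over the same objects: posets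
with three prescribed restrictions, and ordered splittings into three blocks. Compatibility holds
because a poset with a cut is freely determined by its restrictions to the two sides
(`exists_isCut`, `IsCut.ext`).

The antipode is the geometric series of `convOne - id` for convolution. On a poset of size `p` its
terms vanish beyond the power `p`, because every factor must receive a nonempty piece
(`convPow_F_eq_zero`).

For a family `C`, only closure under restrictions and under ordinal sums matters (`IsClosedFamily`).
The first makes the complementary span an ideal, the second a coideal, and the antipode preserves it
because convolution powers do.

Closure follows from a local criterion. A poset has a maximum linear extension iff every relation `a
≺ c` with `a < b < c` gives `a ≺ b` or `b ≺ c`; reversing `<` handles minima, and `WOIP` is the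
intersection of the two families. This condition (`Interpolates`) visibly passes to restrictions and
ordinal sums. -/

noncomputable section

namespace IntegerPosets

/-! ### Bialgebras given by bare operations, convolution, and quotients. -/

section Abstract

universe u v w

variable {K : Type u} {V : Type v} {W : Type w} [Field K]
  [AddCommGroup V] [Module K V] [AddCommGroup W] [Module K W]

/-- The bialgebra axioms for the operations `O`. -/
structure Ops.IsBialgebra (O : Ops K V) : Prop where
  one_mul : ∀ x, O.mul O.one x = x
  mul_one : ∀ x, O.mul x O.one = x
  mul_assoc : ∀ x y z, O.mul (O.mul x y) z = O.mul x (O.mul y z)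
  coassoc : ∀ x, TensorProduct.assoc K V V V
      (TensorProduct.map O.comul LinearMap.id (O.comul x)) =
    TensorProduct.map LinearMap.id O.comul (O.comul x)
  counit_left : ∀ x, TensorProduct.map O.counit LinearMap.id (O.comul x) = 1 ⊗ₜ[K] x
  counit_right : ∀ x, TensorProduct.map LinearMap.id O.counit (O.comul x) = x ⊗ₜ[K] 1
  counit_one : O.counit O.one = 1
  counit_mul : ∀ x y, O.counit (O.mul x y) = O.counit x * O.counit y
  comul_one : O.comul O.one = O.one ⊗ₜ[K] O.one
  comul_mul : ∀ x y, O.comul (O.mul x y) =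
    TensorProduct.map₂ O.mul O.mul (O.comul x) (O.comul y)

/-- The convolution product of two endomorphisms. -/
def Ops.conv (O : Ops K V) (f g : V →ₗ[K] V) : V →ₗ[K] V :=
  TensorProduct.lift O.mul ∘ₗ TensorProduct.map f g ∘ₗ O.comul

/-- The unit of the convolution product. -/
def Ops.convOne (O : Ops K V) : V →ₗ[K] V := O.counit.smulRight O.one

/-- The convolution powers of `convOne - id`. -/
def Ops.convPow (O : Ops K V) : ℕ → V →ₗ[K] V
  | 0 => O.convOne
  | k + 1 => O.conv (O.convOne - LinearMap.id) (O.convPow k)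

namespace Ops.IsBialgebra

variable {O : Ops K V} {O₂ : Ops K W}

/-- The ring structure given by the product and the unit. -/
@[reducible] def toRing (h : O.IsBialgebra) : Ring V :=
  { (inferInstance : AddCommGroup V) with
    mul := fun x y => O.mul x y
    one := O.one
    mul_assoc := h.mul_assoc
    one_mul := h.one_mul
    mul_one := h.mul_one
    left_distrib := fun x y z => (O.mul x).map_add y z
    right_distrib := fun x y z => by
      change O.mul (x + y) z = _
      rw [map_add]; rfl
    zero_mul := fun x => by
      change O.mul 0 x = 0
      rw [map_zero]; rfl
    mul_zero := fun x => (O.mul x).map_zero }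

/-- The algebra structure given by the product and the unit. -/
@[reducible] def toAlgebra (h : O.IsBialgebra) :
    letI := h.toRing
    Algebra K V :=
  letI := h.toRing
  { (inferInstance : Module K V) with
    algebraMap :=
      { toFun := fun c => c • O.one
        map_one' := one_smul _ _
        map_mul' := fun a b => by
          change _ = O.mul (a • O.one) (b • O.one)
          rw [map_smul, map_smul, LinearMap.smul_apply, h.one_mul, smul_smul, mul_comm]
        map_zero' := zero_smul _ _
        map_add' := fun a b => add_smul _ _ _ }
    commutes' := fun r x => by
      change O.mul (r • O.one) x = O.mul x (r • O.one)
      rw [map_smul, map_smul, LinearMap.smul_apply, h.one_mul, h.mul_one]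
    smul_def' := fun r x => by
      change r • x = O.mul (r • O.one) x
      rw [map_smul, LinearMap.smul_apply, h.one_mul] }

/-- The coalgebra structure given by the coproduct and the counit. -/
@[reducible] def toCoalgebra (h : O.IsBialgebra) : Coalgebra K V where
  comul := O.comul
  counit := O.counit
  coassoc := LinearMap.ext h.coassoc
  rTensor_counit_comp_comul := LinearMap.ext h.counit_left
  lTensor_counit_comp_comul := LinearMap.ext h.counit_right

theorem map₂_eq_mul (h : O.IsBialgebra) (x y : V ⊗[K] V) :
    letI := h.toRing
    letI := h.toAlgebra
    TensorProduct.map₂ O.mul O.mul x y = x * y := by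
  let := h.toRing
  let := h.toAlgebra
  induction x with
  | zero => simp
  | add a b ha hb => rw [map_add, LinearMap.add_apply, ha, hb, add_mul]
  | tmul a b =>
    induction y with
    | zero => simp
    | add c d hc hd => rw [map_add, hc, hd, mul_add]
    | tmul c d =>
      rw [TensorProduct.map₂_apply_tmul, Algebra.TensorProduct.tmul_mul_tmul]; rfl

/-- The bialgebra structure given by the operations `O`. -/
@[reducible] def toBialgebra (h : O.IsBialgebra) :
    letI := h.toRing
    Bialgebra K V :=
  letI := h.toRing
  letI := h.toAlgebra
  letI := h.toCoalgebra
  Bialgebra.mk' K V h.counit_one (fun {a b} => h.counit_mul a b) h.comul_one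
    (fun {a b} => (h.comul_mul a b).trans (h.map₂_eq_mul _ _))

theorem isHopfAlgebra (h : O.IsBialgebra) {S : V →ₗ[K] V}
    (hl : O.conv S LinearMap.id = O.convOne) (hr : O.conv LinearMap.id S = O.convOne) :
    O.IsHopfAlgebra S := by
  let := h.toRing
  let := h.toBialgebra
  have hmul : LinearMap.mul' K V = TensorProduct.lift O.mul := by
    ext x y; rfl
  refine ⟨V, h.toRing,
    { h.toBialgebra with
      antipode := S
      mul_antipode_rTensor_comul := ?_
      mul_antipode_lTensor_comul := ?_ }, LinearEquiv.refl K V,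
    fun _ _ => rfl, rfl, fun x => ?_, fun _ => rfl, fun _ => rfl⟩
  · rw [hmul]; exact hl
  · rw [hmul]; exact hr
  · change O.comul x = TensorProduct.map LinearMap.id LinearMap.id (O.comul x)
    simp

/-- In the convolution algebra, `id = 1 - u` with `u = 1 - id`, so this is the telescoping of a
geometric sum. It yields a two-sided inverse of `id` wherever `u ^ n` vanishes. -/
theorem conv_sum_convPow (h : O.IsBialgebra) (n : ℕ) :
    O.conv (∑ k ∈ Finset.range n, O.convPow k) LinearMap.id = O.convOne - O.convPow n ∧
    O.conv LinearMap.id (∑ k ∈ Finset.range n, O.convPow k) = O.convOne - O.convPow n := by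
  let := h.toRing
  let := h.toBialgebra
  have hmul : LinearMap.mul' K V = TensorProduct.lift O.mul := by
    ext x y; rfl
  have hconv : ∀ f g, WithConv.toConv (O.conv f g) = WithConv.toConv f * WithConv.toConv g := by
    intro f g
    rw [LinearMap.convMul_def, hmul]; rfl
  have hone : WithConv.toConv O.convOne = 1 := rfl
  have hpow : ∀ k, WithConv.toConv (O.convPow k)
      = (1 - WithConv.toConv (LinearMap.id : V →ₗ[K] V)) ^ k := by
    intro k
    induction k with
    | zero => exact hone
    | succ k ih =>
      rw [pow_succ', ← ih]
      exact hconv _ _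
  have hsum : WithConv.toConv (∑ k ∈ Finset.range n, O.convPow k) =
      ∑ k ∈ Finset.range n, (1 - WithConv.toConv (LinearMap.id : V →ₗ[K] V)) ^ k := by
    rw [WithConv.toConv_sum]
    exact Finset.sum_congr rfl fun k _ => hpow k
  constructor <;> apply WithConv.toConv_injective <;>
    rw [hconv, hsum, WithConv.toConv_sub, hone, hpow]
  · simpa using geom_sum_mul_neg (1 - WithConv.toConv (LinearMap.id : V →ₗ[K] V)) n
  · simpa using mul_neg_geom_sum (1 - WithConv.toConv (LinearMap.id : V →ₗ[K] V)) n

/-- The bialgebra axioms pass to quotients. -/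
theorem of_surjective (h : O.IsBialgebra) {f : V →ₗ[K] W} (hf : Function.Surjective f)
    (hom : O.IsHom O₂ f) : O₂.IsBialgebra where
  one_mul := hf.forall.2 fun x => by rw [← hom.map_one, ← hom.map_mul, h.one_mul]
  mul_one := hf.forall.2 fun x => by rw [← hom.map_one, ← hom.map_mul, h.mul_one]
  mul_assoc := hf.forall.2 fun x => hf.forall.2 fun y => hf.forall.2 fun z => by
    simp only [← hom.map_mul, h.mul_assoc]
  coassoc := hf.forall.2 fun x => by
    have hc : O₂.comul ∘ₗ f = TensorProduct.map f f ∘ₗ O.comul :=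
      LinearMap.ext fun x => (hom.map_comul x).symm
    -- Naturality of the associator carries coassociativity from `V` to `W`.
    have key : ∀ t, TensorProduct.assoc K W W W
        (TensorProduct.map (TensorProduct.map f f) f t) =
        TensorProduct.map f (TensorProduct.map f f) (TensorProduct.assoc K V V V t) := by
      intro t
      rw [← LinearEquiv.coe_coe, ← LinearMap.comp_apply,
        ← TensorProduct.map_map_comp_assoc_eq]; rfl
    have h1 := congrArg (TensorProduct.map f (TensorProduct.map f f)) (h.coassoc x)
    rw [← key] at h1
    rw [← hom.map_comul]
    simp only [TensorProduct.map_map, hc, LinearMap.id_comp, LinearMap.comp_id] at h1 ⊢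
    exact h1
  counit_left := hf.forall.2 fun x => by
    have hc : O₂.counit ∘ₗ f = O.counit := LinearMap.ext hom.map_counit
    have h1 := congrArg (TensorProduct.map LinearMap.id f) (h.counit_left x)
    rw [← hom.map_comul, TensorProduct.map_map, hc]
    simpa [TensorProduct.map_map] using h1
  counit_right := hf.forall.2 fun x => by
    have hc : O₂.counit ∘ₗ f = O.counit := LinearMap.ext hom.map_counit
    have h1 := congrArg (TensorProduct.map f LinearMap.id) (h.counit_right x)
    rw [← hom.map_comul, TensorProduct.map_map, hc]
    simpa [TensorProduct.map_map] using h1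
  counit_one := by rw [← hom.map_one, hom.map_counit, h.counit_one]
  counit_mul := hf.forall.2 fun x => hf.forall.2 fun y => by
    simp only [← hom.map_mul, hom.map_counit, h.counit_mul]
  comul_one := by rw [← hom.map_one, ← hom.map_comul, h.comul_one, TensorProduct.map_tmul]
  comul_mul := hf.forall.2 fun x => hf.forall.2 fun y => by
    rw [← hom.map_mul, ← hom.map_comul, ← hom.map_comul, ← hom.map_comul, h.comul_mul]
    generalize O.comul x = s
    generalize O.comul y = t
    induction s with
    | zero => simp
    | add a b ha hb => simp only [map_add, LinearMap.add_apply, ha, hb]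
    | tmul a b =>
      induction t with
      | zero => simp
      | add c d hc hd => simp only [map_add, hc, hd]
      | tmul c d => simp [TensorProduct.map₂_apply_tmul, hom.map_mul]

end Ops.IsBialgebra

theorem Ops.IsHom.conv_eq {O : Ops K V} {O₂ : Ops K W} {f : V →ₗ[K] W} (hom : O.IsHom O₂ f)
    {g h : V →ₗ[K] V} {g₂ h₂ : W →ₗ[K] W} (hg : ∀ x, g₂ (f x) = f (g x))
    (hh : ∀ x, h₂ (f x) = f (h x)) (x : V) : O₂.conv g₂ h₂ (f x) = f (O.conv g h x) := by
  simp only [Ops.conv, LinearMap.comp_apply, ← hom.map_comul]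
  generalize O.comul x = t
  induction t with
  | zero => simp
  | add a b ha hb => simp only [map_add, ha, hb]
  | tmul a b => simp [hg, hh, hom.map_mul]

theorem Ops.IsHom.convOne_eq {O : Ops K V} {O₂ : Ops K W} {f : V →ₗ[K] W} (hom : O.IsHom O₂ f)
    (x : V) : O₂.convOne (f x) = f (O.convOne x) := by
  simp [Ops.convOne, hom.map_counit, hom.map_one]

/-- A two-sided ideal which is a coideal. -/
structure Ops.IsBiideal (O : Ops K V) (I : Submodule K V) : Prop where
  mul_mem_left : ∀ x, ∀ y ∈ I, O.mul x y ∈ I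
  mul_mem_right : ∀ x ∈ I, ∀ y, O.mul x y ∈ I
  comul_mem : ∀ x ∈ I, O.comul x ∈
    LinearMap.range (TensorProduct.map I.subtype (LinearMap.id : V →ₗ[K] V)) ⊔
      LinearMap.range (TensorProduct.map (LinearMap.id : V →ₗ[K] V) I.subtype)
  counit_eq_zero : ∀ x ∈ I, O.counit x = 0

/-! ### Biideals and their quotient Hopf algebras. -/

namespace Ops.IsBiideal

variable {O : Ops K V} {I : Submodule K V}

/-- The coproduct of `x` lies in `I ⊗ V + V ⊗ I`, and `f` kills both summands. This serves both the
induced coproduct and the stability of `I` under convolution. -/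
theorem map_comul_eq_zero (h : O.IsBiideal I) {f : V ⊗[K] V →ₗ[K] W}
    (hl : ∀ x ∈ I, ∀ y, f (x ⊗ₜ y) = 0) (hr : ∀ x, ∀ y ∈ I, f (x ⊗ₜ y) = 0) {x : V} (hx : x ∈ I) :
    f (O.comul x) = 0 := by
  have hle : LinearMap.range (TensorProduct.map I.subtype (LinearMap.id : V →ₗ[K] V)) ⊔
      LinearMap.range (TensorProduct.map (LinearMap.id : V →ₗ[K] V) I.subtype) ≤
      LinearMap.ker f := by
    refine sup_le ?_ ?_
    · rw [LinearMap.range_le_ker_iff]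
      ext a b
      exact hl _ a.2 b
    · rw [LinearMap.range_le_ker_iff]
      ext a b
      exact hr a _ b.2
  exact hle (h.comul_mem x hx)

theorem conv_mem (h : O.IsBiideal I) {f g : V →ₗ[K] V} (hf : ∀ x ∈ I, f x ∈ I)
    (hg : ∀ x ∈ I, g x ∈ I) {x : V} (hx : x ∈ I) : O.conv f g x ∈ I := by
  rw [← Submodule.Quotient.mk_eq_zero, ← Submodule.mkQ_apply]
  refine h.map_comul_eq_zero (f := I.mkQ ∘ₗ TensorProduct.lift O.mul ∘ₗ TensorProduct.map f g)
    ?_ ?_ hx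
  · intro a ha b
    simpa using h.mul_mem_right _ (hf a ha) _
  · intro a b hb
    simpa using h.mul_mem_left _ _ (hg b hb)

theorem convOne_mem (h : O.IsBiideal I) {x : V} (hx : x ∈ I) : O.convOne x ∈ I := by
  simp [Ops.convOne, h.counit_eq_zero x hx]

/-- This gives stability under the antipode, which on each basis element is a finite sum of such
powers. -/
theorem convPow_mem (h : O.IsBiideal I) (k : ℕ) : ∀ x ∈ I, O.convPow k x ∈ I := by
  induction k with
  | zero => exact fun x hx => h.convOne_mem hx
  | succ k ih =>
    exact fun x hx => h.conv_mem (fun y hy => I.sub_mem (h.convOne_mem hy) hy) ih hx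

/-- The operations induced on the quotient by a biideal. -/
def quotientOps (h : O.IsBiideal I) : Ops K (V ⧸ I) where
  -- The product descends one variable at a time: the inner lift treats the right factor, the outer
  -- one the left factor.
  mul := I.liftQ (LinearMap.flip (I.liftQ (LinearMap.flip (O.mul.compr₂ I.mkQ))
      fun y hy => LinearMap.ext fun x => (Submodule.Quotient.mk_eq_zero I).2 (h.mul_mem_left x y hy)))
    fun x hx => LinearMap.ext fun y => by
      obtain ⟨y, rfl⟩ := I.mkQ_surjective y
      exact (Submodule.Quotient.mk_eq_zero I).2 (h.mul_mem_right x hx y)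
  one := I.mkQ O.one
  comul := I.liftQ (TensorProduct.map I.mkQ I.mkQ ∘ₗ O.comul) fun x hx =>
    LinearMap.mem_ker.2 <| h.map_comul_eq_zero (f := TensorProduct.map I.mkQ I.mkQ)
      (fun a ha b => by simp [(Submodule.Quotient.mk_eq_zero I).2 ha])
      (fun a b hb => by simp [(Submodule.Quotient.mk_eq_zero I).2 hb]) hx
  counit := I.liftQ O.counit h.counit_eq_zero

theorem isHom_mkQ (h : O.IsBiideal I) : O.IsHom h.quotientOps I.mkQ where
  map_mul _ _ := rfl
  map_one := rfl
  map_comul _ := rfl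
  map_counit _ := rfl

theorem isHopfIdeal (h : O.IsBiideal I) {S : V →ₗ[K] V} (hS : ∀ x ∈ I, S x ∈ I) :
    O.IsHopfIdeal S I :=
  ⟨h.mul_mem_left, h.mul_mem_right, h.comul_mem, h.counit_eq_zero, hS⟩

theorem isHopfAlgebra_quotientOps (h : O.IsBiideal I) (hO : O.IsBialgebra) {S : V →ₗ[K] V}
    (hl : O.conv S LinearMap.id = O.convOne) (hr : O.conv LinearMap.id S = O.convOne)
    (hS : ∀ x ∈ I, S x ∈ I) : h.quotientOps.IsHopfAlgebra (I.mapQ I S hS) := by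
  have hom := h.isHom_mkQ
  refine (hO.of_surjective I.mkQ_surjective hom).isHopfAlgebra ?_ ?_ <;>
    refine LinearMap.ext (I.mkQ_surjective.forall.2 fun x => ?_)
  · rw [hom.conv_eq (g := S) (h := LinearMap.id) (fun _ => rfl) (fun _ => rfl), hl, hom.convOne_eq]
  · rw [hom.conv_eq (g := LinearMap.id) (h := S) (fun _ => rfl) (fun _ => rfl), hr, hom.convOne_eq]

end Ops.IsBiideal

end Abstract

section Combinatorics

universe u

open Classical

/-! ### Pulling posets back along order embeddings -/

/-- The pullback of an integer poset along an order embedding. -/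
def pull {k p : ℕ} (T : IPos p) (f : Fin k ↪o Fin p) : IPos k :=
  ⟨⟨fun i j => T.1.1 (f i) (f j), fun _ => T.1.2 _⟩,
    fun _ _ _ => T.2.1 _ _ _, fun _ _ h h' => f.injective (T.2.2 _ _ h h')⟩

theorem pull_apply {k p : ℕ} (T : IPos p) (f : Fin k ↪o Fin p) (i j : Fin k) :
    (pull T f).1.1 i j = T.1.1 (f i) (f j) := rfl

theorem pull_pull {k l p : ℕ} (T : IPos p) (f : Fin k ↪o Fin p) (g : Fin l ↪o Fin k) :
    pull (pull T f) g = pull T (g.trans f) := rfl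

theorem ipos_ext {n : ℕ} {P Q : IPos n} (h : ∀ i j, P.1.1 i j ↔ Q.1.1 i j) : P = Q :=
  Subtype.ext <| Subtype.ext <| funext fun i => funext fun j => propext (h i j)

instance : Unique (IPos 0) where
  default := emptyPos
  uniq _ := ipos_ext fun i => i.elim0

/-- A strictly increasing map out of `Fin a` is determined by its range. Comparing basis elements
rather than posets avoids transport along `a = b`. -/
theorem F_pull_eq_of_range_eq (K : Type u) [Field K] {a b p : ℕ} (T : IPos p) {f : Fin a ↪o Fin p}
    {g : Fin b ↪o Fin p} (h : Set.range f = Set.range g) : F K (pull T f) = F K (pull T g) := by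
  have hab : a = b := by
    simpa [Set.ncard_range_of_injective f.injective, Set.ncard_range_of_injective g.injective]
      using congrArg Set.ncard h
  subst hab
  rw [show f = g from DFunLike.coe_injective ((f.strictMono.range_inj g.strictMono).1 h)]

/-- `f` and `g` identify `Fin k` with the ordinal sum of `Fin m` and `Fin n`. -/
structure IsConcat {m n k : ℕ} (f : Fin m ↪o Fin k) (g : Fin n ↪o Fin k) : Prop where
  lt : ∀ i j, f i < g j
  cover : ∀ x, x ∈ Set.range f ∨ x ∈ Set.range g

theorem IsConcat.exists_cast {m n k : ℕ} {f : Fin m ↪o Fin k} {g : Fin n ↪o Fin k}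
    (h : IsConcat f g) : ∃ e : m + n = k, (∀ i, f i = Fin.cast e (Fin.castAdd n i)) ∧
      ∀ j, g j = Fin.cast e (Fin.natAdd m j) := by
  let φ : Fin (m + n) → Fin k := Fin.addCases f g
  have hφ : StrictMono φ := by
    intro x y
    refine Fin.addCases (fun i => ?_) (fun i => ?_) x <;>
      refine Fin.addCases (fun j => ?_) (fun j => ?_) y <;> intro hxy
    · have : i < j := hxy
      simpa [φ] using this
    · simpa [φ] using h.lt i j
    · simp [Fin.lt_def] at hxy; omega
    · simpa [φ] using hxy
  have hs : Function.Surjective φ := by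
    intro x
    obtain ⟨i, rfl⟩ | ⟨j, rfl⟩ := h.cover x
    · exact ⟨Fin.castAdd n i, by simp [φ]⟩
    · exact ⟨Fin.natAdd m j, by simp [φ]⟩
  have e : m + n = k := by simpa using Fintype.card_of_bijective ⟨hφ.injective, hs⟩
  have hφe : ∀ x, φ x = Fin.cast e x := by
    intro x
    exact congrFun ((hφ.range_inj (g := Fin.cast e) (Fin.cast_strictMono e)).1 (by
      rw [hs.range_eq, (Fin.rightInverse_cast e).surjective.range_eq])) x
  exact ⟨e, fun i => by rw [← hφe]; simp [φ], fun j => by rw [← hφe]; simp [φ]⟩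

theorem isConcat_castAdd_natAdd (m n : ℕ) :
    IsConcat (Fin.castAddOrderEmb n : Fin m ↪o _) (Fin.natAddOrderEmb m : Fin n ↪o _) where
  lt i j := by simp [Fin.lt_def]; omega
  cover x := by
    refine Fin.addCases (fun i => ?_) (fun i => ?_) x
    · exact Or.inl ⟨i, rfl⟩
    · exact Or.inr ⟨i, rfl⟩

/-- The cross relations `I` and `D` are arbitrary, so only the two diagonal blocks are constrained.
-/
theorem mem_shiftedShuffle_iff {m n : ℕ} {P : IPos m} {Q : IPos n} {T : IPos (m + n)} :
    T.1 ∈ shiftedShuffle P.1 Q.1 ↔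
      pull T (Fin.castAddOrderEmb n) = P ∧ pull T (Fin.natAddOrderEmb m) = Q := by
  constructor
  · rintro ⟨I, D, h⟩
    constructor <;> refine ipos_ext fun i j => ?_ <;> rw [pull_apply, h] <;> simp [block]
  · rintro ⟨rfl, rfl⟩
    refine ⟨fun i j => T.1.1 (Fin.castAdd n i) (Fin.natAdd m j),
      fun i j => T.1.1 (Fin.natAdd m i) (Fin.castAdd n j), ?_⟩
    refine Subtype.ext <| funext fun x => funext fun y => ?_
    refine Fin.addCases (fun i => ?_) (fun i => ?_) x <;>
      refine Fin.addCases (fun j => ?_) (fun j => ?_) y <;> simp [block, pull_apply]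

/-! ### The product -/

variable (K : Type u) [Field K]

/-- Allowing any `k` with a concatenation, not only `m + n`, lets both bracketings of a triple
product be sums over the same type, and lets products of restrictions be indexed by posets on a
subset. -/
theorem mul_F {m n k : ℕ} {f : Fin m ↪o Fin k} {g : Fin n ↪o Fin k} (h : IsConcat f g)
    (P : IPos m) (Q : IPos n) :
    (posOps K).mul (F K P) (F K Q) = ∑ T : IPos k with pull T f = P ∧ pull T g = Q, F K T := by
  obtain ⟨rfl, hf, hg⟩ := h.exists_cast
  have hf' : f = Fin.castAddOrderEmb n := DFunLike.ext _ _ hf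
  have hg' : g = Fin.natAddOrderEmb m := DFunLike.ext _ _ hg
  subst hf' hg'
  simp only [← mem_shiftedShuffle_iff]
  simp [posOps, F, basisMul]

variable {K}

theorem KIPos_induction {p : KIPos K → Prop} (x : KIPos K) (hF : ∀ n (P : IPos n), p (F K P))
    (h0 : p 0) (hadd : ∀ x y, p x → p y → p (x + y)) (hsmul : ∀ (c : K) x, p x → p (c • x)) :
    p x := by
  induction x using Finsupp.induction_linear with
  | zero => exact h0
  | add x y hx hy => exact hadd x y hx hy
  | single P c =>
    have := hsmul c _ (hF P.1 P.2)
    rwa [F, Finsupp.smul_single, smul_eq_mul, mul_one] at this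

theorem KIPos_hom_ext {M : Type*} [AddCommGroup M] [Module K M] {f g : KIPos K →ₗ[K] M}
    (h : ∀ n (P : IPos n), f (F K P) = g (F K P)) : f = g :=
  Finsupp.lhom_ext' fun P => LinearMap.ext_ring (h P.1 P.2)

theorem sum_fiberwise_filter {α β M : Type*} [Fintype α] [Fintype β] [AddCommMonoid M] (h : β → α)
    (c : α → Prop) (d : β → Prop) (φ : β → M) [DecidablePred c]
    [∀ a, DecidablePred fun b => h b = a ∧ d b] [DecidablePred fun b => c (h b) ∧ d b] :
    ∑ a with c a, ∑ b with h b = a ∧ d b, φ b = ∑ b with c (h b) ∧ d b, φ b := by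
  have key : ∀ a, (if c a then ∑ b, (if h b = a ∧ d b then φ b else 0) else 0) =
      ∑ b, if h b = a then (if c (h b) ∧ d b then φ b else 0) else 0 := by
    intro a
    split_ifs with hc
    · refine Finset.sum_congr rfl fun b _ => ?_
      by_cases hb : h b = a <;> simp [hb, hc]
    · refine (Finset.sum_eq_zero fun b _ => ?_).symm
      by_cases hb : h b = a <;> simp [hb, hc]
  simp only [Finset.sum_filter]
  rw [Finset.sum_congr rfl fun a _ => key a, Finset.sum_comm]
  simp

theorem mul_assoc_F {m n k : ℕ} (P : IPos m) (Q : IPos n) (R : IPos k) :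
    (posOps K).mul ((posOps K).mul (F K P) (F K Q)) (F K R) =
      (posOps K).mul (F K P) ((posOps K).mul (F K Q) (F K R)) := by
  let g : Fin (n + k) ↪o Fin (m + n + k) :=
    (Fin.natAddOrderEmb m).trans (Fin.castOrderIso (add_assoc m n k).symm).toOrderEmbedding
  let f : Fin m ↪o Fin (m + n + k) := (Fin.castAddOrderEmb n).trans (Fin.castAddOrderEmb k)
  have hfg : IsConcat f g := {
    lt := fun i j => by simp [f, g, Fin.lt_def]; omega
    cover := fun x => by
      by_cases hx : x.1 < m
      · exact Or.inl ⟨⟨x, hx⟩, rfl⟩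
      · exact Or.inr ⟨⟨x - m, by omega⟩, by ext; simp [g]; omega⟩ }
  have h1 : (Fin.castAddOrderEmb k).trans g =
      (Fin.natAddOrderEmb m : Fin n ↪o _).trans (Fin.castAddOrderEmb k) := by
    ext; simp [g]
  have h2 : (Fin.natAddOrderEmb n).trans g = (Fin.natAddOrderEmb (m + n) : Fin k ↪o _) := by
    ext; simp [g, add_assoc]
  rw [mul_F K (isConcat_castAdd_natAdd m n), mul_F K (isConcat_castAdd_natAdd n k), map_sum,
    map_sum, LinearMap.sum_apply]
  simp only [mul_F K (isConcat_castAdd_natAdd (m + n) k), mul_F K hfg]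
  rw [sum_fiberwise_filter (fun T => pull T (Fin.castAddOrderEmb k))]
  simp only [and_comm (a := pull _ f = P)]
  rw [sum_fiberwise_filter (fun T => pull T g)]
  simp only [pull_pull, h1, h2]
  refine Finset.sum_congr (Finset.filter_congr fun T _ => ?_) fun _ _ => rfl
  simp only [f]
  tauto

theorem one_mul_F {n : ℕ} (P : IPos n) : (posOps K).mul (F K emptyPos) (F K P) = F K P := by
  have h : IsConcat (RelEmbedding.ofIsEmpty (· ≤ ·) (· ≤ ·) : Fin 0 ↪o Fin n)
      (RelEmbedding.refl _) := ⟨fun i => i.elim0, fun x => Or.inr ⟨x, rfl⟩⟩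
  rw [mul_F K h]
  rw [Finset.sum_eq_single_of_mem P]
  · simpa using ⟨Subsingleton.elim _ _, rfl⟩
  · intro T hT hne
    exact absurd (Finset.mem_filter.1 hT).2.2 hne

theorem mul_one_F {n : ℕ} (P : IPos n) : (posOps K).mul (F K P) (F K emptyPos) = F K P := by
  have h : IsConcat (RelEmbedding.refl _)
      (RelEmbedding.ofIsEmpty (· ≤ ·) (· ≤ ·) : Fin 0 ↪o Fin n) :=
    ⟨fun _ j => j.elim0, fun x => Or.inl ⟨x, rfl⟩⟩
  rw [mul_F K h]
  rw [Finset.sum_eq_single_of_mem P]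
  · simpa using ⟨rfl, Subsingleton.elim _ _⟩
  · intro T hT hne
    exact absurd (Finset.mem_filter.1 hT).2.1 hne

/-! ### The coproduct -/

variable (K)

/-- The basis element of the standardized restriction of `T` to `X`. -/
def part {p : ℕ} (T : IPos p) (X : Finset (Fin p)) : KIPos K :=
  F K (pull T (X.orderEmbOfFin rfl))

variable {K}

theorem F_pull_eq_part {k p : ℕ} (T : IPos p) (f : Fin k ↪o Fin p) {X : Finset (Fin p)}
    (h : Set.range f = X) : F K (pull T f) = part K T X :=
  F_pull_eq_of_range_eq K T (by rw [h, Finset.range_orderEmbOfFin])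

theorem part_univ {p : ℕ} (T : IPos p) : part K T Finset.univ = F K T :=
  (F_pull_eq_part T (RelEmbedding.refl _) (by simp)).symm

/-- Iterated restrictions become restrictions to subsets of one ambient set, so iterated coproducts
can be compared there. -/
theorem part_pull {k p : ℕ} (T : IPos p) (f : Fin k ↪o Fin p) (X : Finset (Fin k)) :
    part K (pull T f) X = part K T (X.map f.toEmbedding) := by
  rw [part, pull_pull]
  refine F_pull_eq_part T _ ?_
  rw [Finset.coe_map, ← Finset.range_orderEmbOfFin X rfl, ← Set.range_comp]
  rfl

/-- Every element of `X` is below every element of `Y`. -/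
def IsCut {p : ℕ} (T : IPos p) (X Y : Finset (Fin p)) : Prop :=
  ∀ x ∈ X, ∀ y ∈ Y, T.1.1 x y

theorem isTotalCut_compl_iff {p : ℕ} (T : IPos p) (X : Finset (Fin p)) :
    IsTotalCut T.1 X Xᶜ ↔ IsCut T X Xᶜ := by
  refine ⟨fun h x hx y hy => (h.2 x hx y hy).1, fun h => ⟨isCompl_compl, fun x hx y hy =>
    ⟨h x hx y hy, fun h' => ?_⟩⟩⟩
  obtain rfl := T.2.2 _ _ (h x hx y hy) h'
  exact Finset.mem_compl.1 hy hx

/-- Elements of `X \ Y` and of `Y \ X` would lie below each other. A poset thus has at most one cut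
of each size, which makes the reindexing in `comul_F` injective. -/
theorem IsCut.subset_of_card_eq {p : ℕ} {T : IPos p} {X Y : Finset (Fin p)} (hX : IsCut T X Xᶜ)
    (hY : IsCut T Y Yᶜ) (h : X.card = Y.card) : X = Y := by
  by_contra hne
  obtain ⟨x, hxX, hxY⟩ := Finset.not_subset.1 fun hs => hne (Finset.eq_of_subset_of_card_le hs h.ge)
  obtain ⟨y, hyY, hyX⟩ := Finset.not_subset.1
    fun hs => hne (Finset.eq_of_subset_of_card_le hs h.le).symm
  obtain rfl := T.2.2 _ _ (hX x hxX y (by simpa)) (hY y hyY x (by simpa))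
  exact hyX hxX

theorem comul_F {p : ℕ} (T : IPos p) : (posOps K).comul (F K T) =
    ∑ X : Finset (Fin p) with IsCut T X Xᶜ, part K T X ⊗ₜ[K] part K T Xᶜ := by
  have h : (posOps K).comul (F K T) = basisComul K T := by simp [posOps, F]
  rw [h, basisComul, Finset.sum_sigma']
  symm
  refine Finset.sum_bij (fun X _ => ⟨(X.card, Xᶜ.card),
    (pull T (X.orderEmbOfFin rfl), pull T (Xᶜ.orderEmbOfFin rfl))⟩) ?_ ?_ ?_ ?_
  · intro X hX
    have hX := (Finset.mem_filter.1 hX).2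
    simp only [Finset.mem_sigma, Finset.mem_filter, Finset.mem_univ, true_and]
    refine ⟨?_, X, Xᶜ, rfl, rfl, (isTotalCut_compl_iff T X).2 hX, rfl, rfl⟩
    exact Finset.HasAntidiagonal.mem_antidiagonal.2 (by simp)
  · intro X hX Y hY hXY
    exact (Finset.mem_filter.1 hX).2.subset_of_card_eq (Finset.mem_filter.1 hY).2
      (congrArg (fun s => s.1.1) hXY)
  · rintro ⟨⟨m, n⟩, ⟨P, Q⟩⟩ hPQ
    simp only [Finset.mem_sigma, Finset.mem_filter, Finset.mem_univ, true_and] at hPQ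
    obtain ⟨X, Y, rfl, rfl, hc, hP, hQ⟩ := hPQ.2
    obtain rfl : Xᶜ = Y := hc.1.compl_eq
    obtain rfl : pull T (X.orderEmbOfFin rfl) = P := Subtype.ext hP
    obtain rfl : pull T (Xᶜ.orderEmbOfFin rfl) = Q := Subtype.ext hQ
    exact ⟨X, Finset.mem_filter.2 ⟨Finset.mem_univ _, (isTotalCut_compl_iff T X).1 hc⟩, rfl⟩
  · intro X _
    rfl

theorem comul_part {p : ℕ} (T : IPos p) (A : Finset (Fin p)) : (posOps K).comul (part K T A) =
    ∑ X ∈ A.powerset with IsCut T X (A \ X), part K T X ⊗ₜ[K] part K T (A \ X) := by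
  rw [part, comul_F]
  set f := A.orderEmbOfFin rfl with hf
  have hA : Finset.univ.map f.toEmbedding = A := by
    rw [← Finset.coe_inj, Finset.coe_map, Finset.coe_univ, Set.image_univ]
    exact Finset.range_orderEmbOfFin A rfl
  have hcompl : ∀ X : Finset (Fin A.card),
      Xᶜ.map f.toEmbedding = A \ X.map f.toEmbedding := by
    intro X
    rw [Finset.compl_eq_univ_sdiff, Finset.map_sdiff, hA]
  refine Finset.sum_bij (fun X _ => X.map f.toEmbedding) ?_ ?_ ?_ ?_
  · intro X hX
    have hX := (Finset.mem_filter.1 hX).2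
    refine Finset.mem_filter.2 ⟨Finset.mem_powerset.2 ?_, ?_⟩
    · exact (Finset.map_subset_map.2 (Finset.subset_univ X)).trans hA.le
    · rw [← hcompl]
      intro x hx y hy
      obtain ⟨i, hi, rfl⟩ := Finset.mem_map.1 hx
      obtain ⟨j, hj, rfl⟩ := Finset.mem_map.1 hy
      exact hX i hi j hj
  · intro X _ Y _ h
    exact Finset.map_injective _ h
  · intro X hX
    obtain ⟨hXA, hX⟩ := Finset.mem_filter.1 hX
    obtain ⟨Y, -, rfl⟩ := Finset.subset_map_iff.1 ((Finset.mem_powerset.1 hXA).trans hA.ge)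
    refine ⟨Y, Finset.mem_filter.2 ⟨Finset.mem_univ _, ?_⟩, rfl⟩
    rw [← hcompl] at hX
    exact fun x hx y hy => hX _ (Finset.mem_map_of_mem _ hx) _ (Finset.mem_map_of_mem _ hy)
  · intro X _
    rw [part_pull, part_pull, hcompl]

theorem coassoc_F {p : ℕ} (T : IPos p) :
    TensorProduct.assoc K (KIPos K) (KIPos K) (KIPos K)
      (TensorProduct.map (posOps K).comul LinearMap.id ((posOps K).comul (F K T))) =
    TensorProduct.map LinearMap.id (posOps K).comul ((posOps K).comul (F K T)) := by
  rw [← part_univ T, comul_part]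
  simp only [map_sum, TensorProduct.map_tmul, comul_part, TensorProduct.sum_tmul,
    TensorProduct.tmul_sum, TensorProduct.assoc_tmul, LinearMap.id_apply]
  rw [Finset.sum_sigma', Finset.sum_sigma']
  -- Both sides range over splittings into three successive blocks, coded on the left by the union
  -- of the first two and the first, on the right by the first and the second.
  refine Finset.sum_bij' (fun XY _ => ⟨XY.2, XY.1 \ XY.2⟩) (fun YZ _ => ⟨YZ.1 ∪ YZ.2, YZ.1⟩)
    ?_ ?_ ?_ ?_ ?_
  · rintro ⟨X, Y⟩ h
    simp only [Finset.mem_sigma, Finset.mem_filter, Finset.mem_powerset] at h ⊢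
    obtain ⟨⟨-, h1⟩, h2, h3⟩ := h
    refine ⟨⟨Finset.subset_univ _, fun x hx y hy => ?_⟩, ?_, fun x hx y hy => ?_⟩
    · by_cases hyX : y ∈ X
      · exact h3 x hx y (by simp_all)
      · exact h1 x (h2 hx) y (by simp_all)
    · exact Finset.sdiff_subset_sdiff (Finset.subset_univ _) le_rfl
    · simp only [Finset.mem_sdiff, Finset.mem_univ, true_and] at hx hy
      exact h1 x hx.1 y (by simp; tauto)
  · rintro ⟨Y, Z⟩ h
    simp only [Finset.mem_sigma, Finset.mem_filter, Finset.mem_powerset] at h ⊢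
    obtain ⟨⟨-, h1⟩, h2, h3⟩ := h
    refine ⟨⟨Finset.subset_univ _, fun x hx y hy => ?_⟩, Finset.subset_union_left,
      fun x hx y hy => ?_⟩
    · simp only [Finset.mem_sdiff, Finset.mem_univ, true_and, Finset.mem_union, not_or] at hx hy
      obtain hx | hx := hx
      · exact h1 x hx y (by simp; tauto)
      · exact h3 x hx y (by simp; tauto)
    · simp only [Finset.mem_sdiff, Finset.mem_union] at hy
      exact h1 x hx y (by simp; tauto)
  · rintro ⟨X, Y⟩ h
    simp only [Finset.mem_sigma, Finset.mem_filter, Finset.mem_powerset] at h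
    simp [Finset.union_sdiff_of_subset h.2.1]
  · rintro ⟨Y, Z⟩ h
    simp only [Finset.mem_sigma, Finset.mem_filter, Finset.mem_powerset] at h
    have : Disjoint Z Y := Finset.disjoint_of_subset_left h.2.1 Finset.sdiff_disjoint
    simp [Finset.union_sdiff_left, this.sdiff_eq_left]
  · rintro ⟨X, Y⟩ h
    simp only [Finset.mem_sigma, Finset.mem_filter, Finset.mem_powerset] at h
    rw [sdiff_sdiff_left, Finset.sup_eq_union, Finset.union_sdiff_of_subset h.2.1]

theorem counit_F {p : ℕ} (T : IPos p) : (posOps K).counit (F K T) = if p = 0 then 1 else 0 := by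
  simp [posOps, F]

theorem counit_part {p : ℕ} (T : IPos p) (X : Finset (Fin p)) :
    (posOps K).counit (part K T X) = if X = ∅ then 1 else 0 := by
  rw [part, counit_F]
  simp

theorem counit_left_F {p : ℕ} (T : IPos p) :
    TensorProduct.map (posOps K).counit LinearMap.id ((posOps K).comul (F K T)) =
      1 ⊗ₜ[K] F K T := by
  rw [comul_F, map_sum, Finset.sum_eq_single_of_mem ∅]
  · simp [counit_part, part_univ]
  · simp [IsCut]
  · intro X _ hX
    simp [counit_part, hX]

theorem counit_right_F {p : ℕ} (T : IPos p) :
    TensorProduct.map LinearMap.id (posOps K).counit ((posOps K).comul (F K T)) =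
      F K T ⊗ₜ[K] 1 := by
  rw [comul_F, map_sum, Finset.sum_eq_single_of_mem Finset.univ]
  · simp [counit_part, part_univ]
  · simp [IsCut]
  · intro X _ hX
    simp [counit_part, hX]

theorem counit_mul_F {m n : ℕ} (P : IPos m) (Q : IPos n) :
    (posOps K).counit ((posOps K).mul (F K P) (F K Q)) =
      (posOps K).counit (F K P) * (posOps K).counit (F K Q) := by
  rcases Nat.eq_zero_or_pos m with rfl | hm
  · rw [Subsingleton.elim P emptyPos, one_mul_F, counit_F emptyPos]
    simp
  · rw [mul_F K (isConcat_castAdd_natAdd m n), map_sum, Finset.sum_eq_zero]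
    · rw [counit_F, if_neg hm.ne', zero_mul]
    · intro T _
      rw [counit_F, if_neg (by omega)]

theorem comul_one_F : (posOps K).comul (F K emptyPos) = F K emptyPos ⊗ₜ[K] F K emptyPos := by
  have h : ∀ X : Finset (Fin 0), part K emptyPos X = F K emptyPos := fun X => by
    rw [Subsingleton.elim X Finset.univ, part_univ]
  rw [comul_F, Finset.sum_eq_single_of_mem ∅]
  · rw [h, h]
  · exact Finset.mem_filter.2 ⟨Finset.mem_univ _, fun x => x.elim0⟩
  · intro X _ hX
    exact absurd (Subsingleton.elim _ _) hX

end Combinatorics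

section Compatibility

universe u

open Classical

variable {K : Type u} [Field K]

/-! ### Compatibility of the product and the coproduct -/

theorem exists_trans_eq {a c p : ℕ} (f : Fin a ↪o Fin p) (g : Fin c ↪o Fin p)
    (h : Set.range f ⊆ Set.range g) : ∃ e : Fin a ↪o Fin c, e.trans g = f := by
  choose e he using fun i => h ⟨i, rfl⟩
  exact ⟨OrderEmbedding.ofMapLEIff e fun i j => by rw [← g.le_iff_le, he, he, f.le_iff_le],
    DFunLike.ext _ _ he⟩

theorem exists_orderEmbOfFin_eq {p : ℕ} {X : Finset (Fin p)} {x : Fin p} (hx : x ∈ X) :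
    ∃ i, X.orderEmbOfFin rfl i = x := by
  rw [← Finset.mem_coe, ← Finset.range_orderEmbOfFin X rfl] at hx
  exact hx

/-- A total cut prescribes all relations between its two sides, leaving only the restrictions free.
-/
theorem IsTotalCut.ext {p : ℕ} {T P : IRel p} {X Y : Finset (Fin p)} (hT : IsTotalCut T X Y)
    (hP : IsTotalCut P X Y) (h1 : restrict T X rfl = restrict P X rfl)
    (h2 : restrict T Y rfl = restrict P Y rfl) : T = P := by
  obtain rfl := hT.1.compl_eq
  refine Subtype.ext <| funext fun x => funext fun y => propext ?_
  by_cases hx : x ∈ X <;> by_cases hy : y ∈ X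
  · obtain ⟨i, rfl⟩ := exists_orderEmbOfFin_eq hx
    obtain ⟨j, rfl⟩ := exists_orderEmbOfFin_eq hy
    exact iff_of_eq (congrFun (congrFun (Subtype.ext_iff.1 h1) i) j)
  · rw [← Finset.mem_compl] at hy
    exact iff_of_true (hT.2 x hx y hy).1 (hP.2 x hx y hy).1
  · rw [← Finset.mem_compl] at hx
    exact iff_of_false (hT.2 y hy x hx).2 (hP.2 y hy x hx).2
  · obtain ⟨i, rfl⟩ := exists_orderEmbOfFin_eq (Finset.mem_compl.2 hx)
    obtain ⟨j, rfl⟩ := exists_orderEmbOfFin_eq (Finset.mem_compl.2 hy)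
    exact iff_of_eq (congrFun (congrFun (Subtype.ext_iff.1 h2) i) j)

theorem IsCut.ext {p : ℕ} {T P : IPos p} {X : Finset (Fin p)} (hT : IsCut T X Xᶜ)
    (hP : IsCut P X Xᶜ) (h1 : pull T (X.orderEmbOfFin rfl) = pull P (X.orderEmbOfFin rfl))
    (h2 : pull T (Xᶜ.orderEmbOfFin rfl) = pull P (Xᶜ.orderEmbOfFin rfl)) : T = P :=
  Subtype.ext <| ((isTotalCut_compl_iff T X).2 hT).ext ((isTotalCut_compl_iff P X).2 hP)
    (Subtype.ext_iff.1 h1) (Subtype.ext_iff.1 h2)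

/-- Posets on `X` and on its complement are the restrictions of a poset with a cut. -/
theorem exists_isCut {p : ℕ} (X : Finset (Fin p)) (t : IPos X.card) (t' : IPos Xᶜ.card) :
    ∃ T : IPos p, IsCut T X Xᶜ ∧ pull T (X.orderEmbOfFin rfl) = t ∧
      pull T (Xᶜ.orderEmbOfFin rfl) = t' := by
  set f := X.orderEmbOfFin rfl
  set g := Xᶜ.orderEmbOfFin rfl
  have hf : ∀ i, f i ∈ X := fun i => Finset.orderEmbOfFin_mem _ _ _
  have hg : ∀ i, g i ∉ X := fun i => Finset.mem_compl.1 (Finset.orderEmbOfFin_mem _ _ _)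
  have hcases : ∀ x, (∃ i, f i = x) ∨ ∃ i, g i = x := fun x =>
    (Classical.em (x ∈ X)).imp exists_orderEmbOfFin_eq fun h =>
      exists_orderEmbOfFin_eq (Finset.mem_compl.2 h)
  let r : Fin p → Fin p → Prop := fun x y =>
    (∃ i j, f i = x ∧ f j = y ∧ t.1.1 i j) ∨ (∃ i j, g i = x ∧ g j = y ∧ t'.1.1 i j) ∨
      x ∈ X ∧ y ∉ X
  have rff : ∀ i j, r (f i) (f j) ↔ t.1.1 i j := fun i j => by
    have : ∀ k l, g k ≠ f l := fun k l h => hg k (h ▸ hf l)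
    simp [r, hf, this]
  have rgg : ∀ i j, r (g i) (g j) ↔ t'.1.1 i j := fun i j => by
    have : ∀ k l, f k ≠ g l := fun k l h => hg l (h ▸ hf k)
    simp [r, hg, this]
  have rfg : ∀ i j, r (f i) (g j) := fun i j => Or.inr (Or.inr ⟨hf i, hg j⟩)
  have rgf : ∀ i j, ¬ r (g i) (f j) := fun i j => by
    have : ∀ k l, f k ≠ g l := fun k l h => hg l (h ▸ hf k)
    have : ∀ k l, g k ≠ f l := fun k l h => hg k (h ▸ hf l)
    simp [r, *]
  have hrefl : ∀ x, r x x := fun x => by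
    obtain ⟨i, rfl⟩ | ⟨i, rfl⟩ := hcases x
    · exact (rff i i).2 (t.1.2 i)
    · exact (rgg i i).2 (t'.1.2 i)
  have hpos : IRel.IsPoset ⟨r, hrefl⟩ := by
    constructor
    · intro x y z
      obtain ⟨i, rfl⟩ | ⟨i, rfl⟩ := hcases x <;> obtain ⟨j, rfl⟩ | ⟨j, rfl⟩ := hcases y <;>
        obtain ⟨k, rfl⟩ | ⟨k, rfl⟩ := hcases z <;>
        simp only [rff, rgg, rfg, rgf, false_imp_iff, imp_true_iff]
      · exact t.2.1 i j k
      · exact t'.2.1 i j k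
    · intro x y
      obtain ⟨i, rfl⟩ | ⟨i, rfl⟩ := hcases x <;> obtain ⟨j, rfl⟩ | ⟨j, rfl⟩ := hcases y <;>
        simp only [rff, rgg, rfg, rgf, false_imp_iff, imp_true_iff]
      · exact fun h h' => congrArg f (t.2.2 i j h h')
      · exact fun h h' => congrArg g (t'.2.2 i j h h')
  exact ⟨⟨⟨r, hrefl⟩, hpos⟩, fun x hx y hy => Or.inr (Or.inr ⟨hx, Finset.mem_compl.1 hy⟩),
    ipos_ext rff, ipos_ext rgg⟩

/-- The disjoint union of `X` and of `Y` shifted by `m`. -/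
def shiftedUnion {m n : ℕ} (X : Finset (Fin m)) (Y : Finset (Fin n)) : Finset (Fin (m + n)) :=
  Finset.univ.filter fun x => Fin.addCases (· ∈ X) (· ∈ Y) x

@[simp] theorem castAdd_mem_shiftedUnion {m n : ℕ} {X : Finset (Fin m)} {Y : Finset (Fin n)}
    {i : Fin m} : Fin.castAdd n i ∈ shiftedUnion X Y ↔ i ∈ X := by
  simp [shiftedUnion]

@[simp] theorem natAdd_mem_shiftedUnion {m n : ℕ} {X : Finset (Fin m)} {Y : Finset (Fin n)}
    {j : Fin n} : Fin.natAdd m j ∈ shiftedUnion X Y ↔ j ∈ Y := by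
  simp [shiftedUnion]

theorem finset_fin_add_ext {m n : ℕ} {Z Z' : Finset (Fin (m + n))}
    (h1 : ∀ i : Fin m, Fin.castAdd n i ∈ Z ↔ Fin.castAdd n i ∈ Z')
    (h2 : ∀ j : Fin n, Fin.natAdd m j ∈ Z ↔ Fin.natAdd m j ∈ Z') : Z = Z' :=
  Finset.ext fun x => Fin.addCases h1 h2 x

theorem compl_shiftedUnion {m n : ℕ} (X : Finset (Fin m)) (Y : Finset (Fin n)) :
    (shiftedUnion X Y)ᶜ = shiftedUnion Xᶜ Yᶜ :=
  finset_fin_add_ext (by simp) (by simp)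

/-- Subsets of `Fin (m + n)` are pairs of subsets of `Fin m` and `Fin n`. -/
def shiftedUnionEquiv (m n : ℕ) :
    Finset (Fin m) × Finset (Fin n) ≃ Finset (Fin (m + n)) where
  toFun XY := shiftedUnion XY.1 XY.2
  invFun Z := (Finset.univ.filter fun i => Fin.castAdd n i ∈ Z,
    Finset.univ.filter fun j => Fin.natAdd m j ∈ Z)
  left_inv XY := by ext <;> simp
  right_inv Z := finset_fin_add_ext (by simp) (by simp)

theorem exists_isConcat_shiftedUnion {m n : ℕ} (X : Finset (Fin m)) (Y : Finset (Fin n)) :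
    ∃ (f : Fin X.card ↪o Fin (shiftedUnion X Y).card)
      (g : Fin Y.card ↪o Fin (shiftedUnion X Y).card), IsConcat f g ∧
      f.trans ((shiftedUnion X Y).orderEmbOfFin rfl) =
        (X.orderEmbOfFin rfl).trans (Fin.castAddOrderEmb n) ∧
      g.trans ((shiftedUnion X Y).orderEmbOfFin rfl) =
        (Y.orderEmbOfFin rfl).trans (Fin.natAddOrderEmb m) := by
  set e := (shiftedUnion X Y).orderEmbOfFin rfl with he
  obtain ⟨f, hf⟩ := exists_trans_eq ((X.orderEmbOfFin rfl).trans (Fin.castAddOrderEmb n)) e (by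
    rw [he, Finset.range_orderEmbOfFin]
    rintro _ ⟨i, rfl⟩
    exact castAdd_mem_shiftedUnion.2 (Finset.orderEmbOfFin_mem X rfl i))
  obtain ⟨g, hg⟩ := exists_trans_eq ((Y.orderEmbOfFin rfl).trans (Fin.natAddOrderEmb m)) e (by
    rw [he, Finset.range_orderEmbOfFin]
    rintro _ ⟨i, rfl⟩
    exact natAdd_mem_shiftedUnion.2 (Finset.orderEmbOfFin_mem Y rfl i))
  have hf' : ∀ i, e (f i) = Fin.castAdd n (X.orderEmbOfFin rfl i) := DFunLike.ext_iff.1 hf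
  have hg' : ∀ i, e (g i) = Fin.natAdd m (Y.orderEmbOfFin rfl i) := DFunLike.ext_iff.1 hg
  refine ⟨f, g, ⟨fun i j => ?_, fun x => ?_⟩, hf, hg⟩
  · rw [← e.lt_iff_lt, hf', hg', Fin.lt_def, Fin.val_castAdd, Fin.val_natAdd]
    omega
  · have hx : e x ∈ shiftedUnion X Y := Finset.orderEmbOfFin_mem _ _ _
    obtain ⟨y, hy⟩ : ∃ y, e x = y := ⟨_, rfl⟩
    rw [hy] at hx
    induction y using Fin.addCases with
    | left i =>
      obtain ⟨k, rfl⟩ := exists_orderEmbOfFin_eq (castAdd_mem_shiftedUnion.1 hx)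
      exact Or.inl ⟨k, e.injective ((hf' k).trans hy.symm)⟩
    | right i =>
      obtain ⟨k, rfl⟩ := exists_orderEmbOfFin_eq (natAdd_mem_shiftedUnion.1 hx)
      exact Or.inr ⟨k, e.injective ((hg' k).trans hy.symm)⟩

/-- `Z` enters through an equation so that the same statement applies to `shiftedUnion X Y` and to
its complement, which is a shifted union only up to rewriting. -/
theorem exists_mul_part_eq_sum {m n : ℕ} (P : IPos m) (Q : IPos n) {X : Finset (Fin m)}
    {Y : Finset (Fin n)} {Z : Finset (Fin (m + n))} (hZ : Z = shiftedUnion X Y) :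
    ∃ c : IPos Z.card → Prop, (∀ T : IPos (m + n), c (pull T (Z.orderEmbOfFin rfl)) ↔
        pull (pull T (Fin.castAddOrderEmb n)) (X.orderEmbOfFin rfl) =
          pull P (X.orderEmbOfFin rfl) ∧
        pull (pull T (Fin.natAddOrderEmb m)) (Y.orderEmbOfFin rfl) =
          pull Q (Y.orderEmbOfFin rfl)) ∧
      (posOps K).mul (part K P X) (part K Q Y) = ∑ t with c t, F K t := by
  subst hZ
  obtain ⟨f, g, hfg, hf, hg⟩ := exists_isConcat_shiftedUnion X Y
  refine ⟨fun t => pull t f = pull P (X.orderEmbOfFin rfl) ∧ pull t g = pull Q (Y.orderEmbOfFin rfl),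
    fun T => ?_, ?_⟩
  · have h1 : pull (pull T ((shiftedUnion X Y).orderEmbOfFin rfl)) f =
        pull (pull T (Fin.castAddOrderEmb n)) (X.orderEmbOfFin rfl) := by
      rw [pull_pull, hf, pull_pull]
    have h2 : pull (pull T ((shiftedUnion X Y).orderEmbOfFin rfl)) g =
        pull (pull T (Fin.natAddOrderEmb m)) (Y.orderEmbOfFin rfl) := by
      rw [pull_pull, hg, pull_pull]
    rw [← h1, ← h2]
  · rw [part, part, mul_F K hfg]

/-- A cut of `T` induces cuts of `P` and `Q`. Conversely, once those are given, `T` amounts to an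
independent choice of its restrictions to the two sides, each a term of a product of pieces of `P`
and `Q`. -/
theorem sum_isCut_shiftedUnion {m n : ℕ} (P : IPos m) (Q : IPos n) (X : Finset (Fin m))
    (Y : Finset (Fin n)) :
    ∑ T : IPos (m + n) with (pull T (Fin.castAddOrderEmb n) = P ∧
        pull T (Fin.natAddOrderEmb m) = Q) ∧ IsCut T (shiftedUnion X Y) (shiftedUnion X Y)ᶜ,
      part K T (shiftedUnion X Y) ⊗ₜ[K] part K T (shiftedUnion X Y)ᶜ =
    if IsCut P X Xᶜ ∧ IsCut Q Y Yᶜ then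
      (posOps K).mul (part K P X) (part K Q Y) ⊗ₜ[K] (posOps K).mul (part K P Xᶜ) (part K Q Yᶜ)
    else 0 := by
  have cutl : ∀ {T : IPos (m + n)}, IsCut T (shiftedUnion X Y) (shiftedUnion X Y)ᶜ →
      IsCut (pull T (Fin.castAddOrderEmb n)) X Xᶜ := fun {T} hT x hx y hy =>
    hT _ (castAdd_mem_shiftedUnion.2 hx) _
      (by rw [compl_shiftedUnion]; exact castAdd_mem_shiftedUnion.2 hy)
  have cutr : ∀ {T : IPos (m + n)}, IsCut T (shiftedUnion X Y) (shiftedUnion X Y)ᶜ →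
      IsCut (pull T (Fin.natAddOrderEmb m)) Y Yᶜ := fun {T} hT x hx y hy =>
    hT _ (natAdd_mem_shiftedUnion.2 hx) _
      (by rw [compl_shiftedUnion]; exact natAdd_mem_shiftedUnion.2 hy)
  split_ifs with hc
  · obtain ⟨c, hcT, hmul⟩ := exists_mul_part_eq_sum (K := K) P Q (X := X) (Y := Y) rfl
    obtain ⟨c', hcT', hmul'⟩ := exists_mul_part_eq_sum (K := K) P Q (compl_shiftedUnion X Y)
    rw [hmul, hmul', TensorProduct.sum_tmul]
    simp only [TensorProduct.tmul_sum]
    rw [← Finset.sum_product']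
    refine Finset.sum_bij (fun T _ => (pull T ((shiftedUnion X Y).orderEmbOfFin rfl),
      pull T ((shiftedUnion X Y)ᶜ.orderEmbOfFin rfl))) ?_ ?_ ?_ ?_
    · intro T hT
      obtain ⟨-, ⟨rfl, rfl⟩, -⟩ := Finset.mem_filter.1 hT
      simp [hcT, hcT']
    · intro T hT T' hT' h
      exact (Finset.mem_filter.1 hT).2.2.ext (Finset.mem_filter.1 hT').2.2
        (congrArg Prod.fst h) (congrArg Prod.snd h)
    · rintro ⟨t, t'⟩ h
      obtain ⟨T, hT, rfl, rfl⟩ := exists_isCut (shiftedUnion X Y) t t'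
      simp only [Finset.mem_product, Finset.mem_filter, Finset.mem_univ, true_and] at h
      have h1 := (hcT T).1 h.1
      have h2 := (hcT' T).1 h.2
      exact ⟨T, Finset.mem_filter.2 ⟨Finset.mem_univ _, ⟨(cutl hT).ext hc.1 h1.1 h2.1,
        (cutr hT).ext hc.2 h1.2 h2.2⟩, hT⟩, rfl⟩
    · intro T _
      rfl
  · refine Finset.sum_eq_zero fun T hT => absurd ?_ hc
    obtain ⟨-, ⟨rfl, rfl⟩, hcut⟩ := Finset.mem_filter.1 hT
    exact ⟨cutl hcut, cutr hcut⟩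

theorem comul_mul_F {m n : ℕ} (P : IPos m) (Q : IPos n) :
    (posOps K).comul ((posOps K).mul (F K P) (F K Q)) =
      TensorProduct.map₂ (posOps K).mul (posOps K).mul ((posOps K).comul (F K P))
        ((posOps K).comul (F K Q)) := by
  rw [mul_F K (isConcat_castAdd_natAdd m n), map_sum]
  simp only [comul_F]
  -- Exchanging the sums fixes the cut set `Z` before `T`; then `Z` splits into its traces on the
  -- two blocks.
  rw [Finset.sum_comm' (s' := fun Z => Finset.univ.filter fun T : IPos (m + n) =>
    (pull T (Fin.castAddOrderEmb n) = P ∧ pull T (Fin.natAddOrderEmb m) = Q) ∧ IsCut T Z Zᶜ)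
    (t' := Finset.univ) (by simp), ← Equiv.sum_comp (shiftedUnionEquiv m n)]
  refine (Finset.sum_congr rfl fun XY _ => sum_isCut_shiftedUnion P Q XY.1 XY.2).trans ?_
  rw [Fintype.sum_prod_type]
  rw [map_sum (TensorProduct.map₂ (posOps K).mul (posOps K).mul), LinearMap.sum_apply,
    Finset.sum_filter]
  refine Finset.sum_congr rfl fun X _ => ?_
  split_ifs with hX
  · simp [hX, ← Finset.sum_filter, TensorProduct.map₂_apply_tmul]
  · simp [hX]

theorem isBialgebra_posOps : (posOps K).IsBialgebra where
  one_mul := by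
    intro x
    induction x using KIPos_induction with
    | hF n P => exact one_mul_F P
    | h0 => simp
    | hadd x y hx hy => rw [map_add, hx, hy]
    | hsmul c x hx => rw [map_smul, hx]
  mul_one := by
    intro x
    induction x using KIPos_induction with
    | hF n P => exact mul_one_F P
    | h0 => simp
    | hadd x y hx hy => rw [map_add, LinearMap.add_apply, hx, hy]
    | hsmul c x hx => rw [map_smul, LinearMap.smul_apply, hx]
  mul_assoc := by
    intro x y z
    induction x using KIPos_induction with
    | h0 => simp
    | hadd x y hx hy => simp only [map_add, LinearMap.add_apply, hx, hy]
    | hsmul c x hx => simp only [map_smul, LinearMap.smul_apply, hx]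
    | hF n P =>
    induction y using KIPos_induction with
    | h0 => simp
    | hadd x y hx hy => simp only [map_add, LinearMap.add_apply, hx, hy]
    | hsmul c x hx => simp only [map_smul, LinearMap.smul_apply, hx]
    | hF n Q =>
    induction z using KIPos_induction with
    | h0 => simp
    | hadd x y hx hy => simp only [map_add, hx, hy]
    | hsmul c x hx => simp only [map_smul, hx]
    | hF n R => exact mul_assoc_F _ _ _
  coassoc := by
    intro x
    induction x using KIPos_induction with
    | h0 => simp
    | hadd x y hx hy => simp only [map_add, hx, hy]
    | hsmul c x hx => simp only [map_smul, hx]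
    | hF n R => exact coassoc_F _
  counit_left := by
    intro x
    induction x using KIPos_induction with
    | h0 => simp
    | hadd x y hx hy => simp only [map_add, hx, hy, TensorProduct.tmul_add]
    | hsmul c x hx => simp only [map_smul, hx, TensorProduct.tmul_smul]
    | hF n R => exact counit_left_F _
  counit_right := by
    intro x
    induction x using KIPos_induction with
    | h0 => simp
    | hadd x y hx hy => simp only [map_add, hx, hy, TensorProduct.add_tmul]
    | hsmul c x hx => simp only [map_smul, hx, TensorProduct.smul_tmul']
    | hF n R => exact counit_right_F _
  counit_one := counit_F emptyPos
  counit_mul := by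
    intro x y
    induction x using KIPos_induction with
    | h0 => simp
    | hadd x y hx hy => simp only [map_add, LinearMap.add_apply, hx, hy, add_mul]
    | hsmul c x hx => simp only [map_smul, LinearMap.smul_apply, hx, smul_mul_assoc]
    | hF n P =>
    induction y using KIPos_induction with
    | h0 => simp
    | hadd x y hx hy => simp only [map_add, hx, hy, mul_add]
    | hsmul c x hx => simp only [map_smul, hx, mul_smul_comm]
    | hF n Q => exact counit_mul_F _ _
  comul_one := comul_one_F
  comul_mul := by
    intro x y
    induction x using KIPos_induction with
    | h0 => simp
    | hadd x y hx hy => simp only [map_add, LinearMap.add_apply, hx, hy]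
    | hsmul c x hx => simp only [map_smul, LinearMap.smul_apply, hx]
    | hF n P =>
    induction y using KIPos_induction with
    | h0 => simp
    | hadd x y hx hy => simp only [map_add, hx, hy]
    | hsmul c x hx => simp only [map_smul, hx]
    | hF n Q => exact comul_mul_F _ _

end Compatibility

section Antipode

universe u

open Classical

variable (K : Type u) [Field K]

/-! ### The antipode -/

/-- The antipode of the integer poset algebra. -/
def antipode : KIPos K →ₗ[K] KIPos K :=
  Finsupp.lift (KIPos K) K (Σ n, IPos n) fun T =>
    -- Powers up to the size of the poset suffice: the higher ones vanish on it.
    ∑ k ∈ Finset.range (T.1 + 1), (posOps K).convPow k (F K T.2)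

variable {K}

theorem antipode_F {p : ℕ} (T : IPos p) :
    antipode K (F K T) = ∑ k ∈ Finset.range (p + 1), (posOps K).convPow k (F K T) := by
  simp [antipode, F]

theorem conv_F (f g : KIPos K →ₗ[K] KIPos K) {p : ℕ} (T : IPos p) :
    (posOps K).conv f g (F K T) = ∑ X : Finset (Fin p) with IsCut T X Xᶜ,
      (posOps K).mul (f (part K T X)) (g (part K T Xᶜ)) := by
  simp [Ops.conv, comul_F]

theorem part_empty {p : ℕ} (T : IPos p) : part K T ∅ = F K emptyPos :=
  (F_pull_eq_part T (RelEmbedding.ofIsEmpty (· ≤ ·) (· ≤ ·) : Fin 0 ↪o Fin p) (by simp)).symm.trans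
    (congrArg (F K) (Subsingleton.elim _ _))

/-- Since `convOne - id` kills the empty poset, each convolution factor uses up at least one
element. -/
theorem convPow_F_eq_zero (k : ℕ) :
    ∀ {p : ℕ} (T : IPos p), p < k → (posOps K).convPow k (F K T) = 0 := by
  induction k with
  | zero => intro p T h; omega
  | succ k ih =>
    intro p T h
    rw [Ops.convPow, conv_F]
    refine Finset.sum_eq_zero fun X _ => ?_
    by_cases hX : X = ∅
    · subst hX
      have h0 : (posOps K).convOne (F K emptyPos) = F K emptyPos := by
        simp [Ops.convOne, counit_F]
        rfl
      simp [part_empty, h0]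
    · have hlt : Xᶜ.card < k := by
        have h1 := X.card_add_card_compl
        have h2 := Finset.card_pos.2 (Finset.nonempty_iff_ne_empty.2 hX)
        rw [Fintype.card_fin] at h1
        omega
      have h0 : (posOps K).convPow k (part K T Xᶜ) = 0 := ih _ hlt
      rw [h0, map_zero]

/-- The truncation depending on the size is replaced by one linear map valid for all pieces of `T`,
to which `conv_sum_convPow` applies. -/
theorem antipode_part {p N : ℕ} (T : IPos p) {X : Finset (Fin p)} (h : X.card < N) :
    antipode K (part K T X) = (∑ k ∈ Finset.range N, (posOps K).convPow k) (part K T X) := by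
  rw [LinearMap.sum_apply, part, antipode_F]
  refine Finset.sum_subset (Finset.range_subset_range.2 h) fun k _ hk => ?_
  exact convPow_F_eq_zero k _ (by simpa using hk)

theorem conv_antipode : (posOps K).conv (antipode K) LinearMap.id = (posOps K).convOne ∧
    (posOps K).conv LinearMap.id (antipode K) = (posOps K).convOne := by
  have hlt : ∀ {p : ℕ} (X : Finset (Fin p)), X.card < p + 1 := fun X =>
    Nat.lt_succ_of_le (by simpa using X.card_le_univ)
  constructor <;> refine KIPos_hom_ext fun p T => ?_ <;> rw [conv_F]
  · simp only [antipode_part T (hlt _)]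
    rw [← conv_F, (isBialgebra_posOps.conv_sum_convPow _).1, LinearMap.sub_apply,
      convPow_F_eq_zero _ _ (Nat.lt_succ_self p), sub_zero]
  · simp only [antipode_part T (hlt _)]
    rw [← conv_F, (isBialgebra_posOps.conv_sum_convPow _).2, LinearMap.sub_apply,
      convPow_F_eq_zero _ _ (Nat.lt_succ_self p), sub_zero]

end Antipode

section Family

universe u

open Classical

/-! ### Families of integer posets closed under restrictions and ordinal sums -/

/-- The family `C` contains the empty poset and is closed under standardized restrictions and
ordinal sums. -/
structure IsClosedFamily (C : ∀ n, Set (IPos n)) : Prop where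
  empty_mem : emptyPos ∈ C 0
  pull_mem : ∀ {k p : ℕ} {T : IPos p} (f : Fin k ↪o Fin p), T ∈ C p → pull T f ∈ C k
  mem_of_isCut : ∀ {p : ℕ} {T : IPos p} {X : Finset (Fin p)}, IsCut T X Xᶜ →
    pull T (X.orderEmbOfFin rfl) ∈ C _ → pull T (Xᶜ.orderEmbOfFin rfl) ∈ C _ → T ∈ C p

variable {K : Type u} [Field K] {C : ∀ n, Set (IPos n)}

theorem complSpan_le {S : Submodule K (KIPos K)} (h : ∀ n (P : IPos n), P ∉ C n → F K P ∈ S) :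
    complSpan K C ≤ S := by
  refine Submodule.span_le.2 ?_
  rintro _ ⟨n, P, hP, rfl⟩
  exact h n P hP

theorem F_mem_complSpan {n : ℕ} {P : IPos n} (hP : P ∉ C n) : F K P ∈ complSpan K C :=
  Submodule.subset_span ⟨n, P, hP, rfl⟩

theorem IsClosedFamily.mem_of_shiftedShuffle (hC : IsClosedFamily C) {m n : ℕ} {P : IPos m}
    {Q : IPos n} {T : IPos (m + n)} (hT : T.1 ∈ shiftedShuffle P.1 Q.1) (h : T ∈ C (m + n)) :
    P ∈ C m ∧ Q ∈ C n := by
  obtain ⟨rfl, rfl⟩ := mem_shiftedShuffle_iff.1 hT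
  exact ⟨hC.pull_mem _ h, hC.pull_mem _ h⟩

/-- A member of the convolution is only a relation at first; it coincides with the poset glued from
`P` and `Q` along the same cut. -/
theorem IsClosedFamily.mem_of_convolution (hC : IsClosedFamily C) {m n p : ℕ} {P : IPos m}
    {Q : IPos n} (hP : P ∈ C m) (hQ : Q ∈ C n) {T : IRel p} (hT : T ∈ convolution p P.1 Q.1) :
    ∃ hT : T.IsPoset, (⟨T, hT⟩ : IPos p) ∈ C p := by
  obtain ⟨X, Y, rfl, rfl, hcut, h1, h2⟩ := hT
  obtain rfl := hcut.1.compl_eq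
  obtain ⟨T', hT', h1', h2'⟩ := exists_isCut X P Q
  obtain rfl : T = T'.1 := hcut.ext ((isTotalCut_compl_iff T' X).2 hT')
    (h1.trans (Subtype.ext_iff.1 h1').symm) (h2.trans (Subtype.ext_iff.1 h2').symm)
  exact ⟨T'.2, hC.mem_of_isCut hT' (h1' ▸ hP) (h2' ▸ hQ)⟩

/-- By contraposition, a shuffle with a factor outside `C` stays outside `C`, and each cut of a
poset outside `C` has a side outside `C`. -/
theorem IsClosedFamily.isBiideal (hC : IsClosedFamily C) :
    (posOps K).IsBiideal (complSpan K C) where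
  mul_mem_left x := by
    refine complSpan_le (S := (complSpan K C).comap ((posOps K).mul x)) fun n Q hQ => ?_
    rw [Submodule.mem_comap]
    induction x using KIPos_induction with
    | h0 => simp
    | hadd x y hx hy => rw [map_add]; exact Submodule.add_mem _ hx hy
    | hsmul c x hx => rw [map_smul]; exact Submodule.smul_mem _ c hx
    | hF m P =>
    rw [mul_F K (isConcat_castAdd_natAdd m n)]
    refine Submodule.sum_mem _ fun T hT => F_mem_complSpan fun h => hQ ?_
    rw [← (Finset.mem_filter.1 hT).2.2]
    exact hC.pull_mem _ h
  mul_mem_right x hx y := by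
    revert x
    refine complSpan_le (S := (complSpan K C).comap ((posOps K).mul.flip y)) fun m P hP => ?_
    rw [Submodule.mem_comap, LinearMap.flip_apply]
    induction y using KIPos_induction with
    | h0 => simp
    | hadd x y hx hy => rw [map_add]; exact Submodule.add_mem _ hx hy
    | hsmul c x hx => rw [map_smul]; exact Submodule.smul_mem _ c hx
    | hF n Q =>
    rw [mul_F K (isConcat_castAdd_natAdd m n)]
    refine Submodule.sum_mem _ fun T hT => F_mem_complSpan fun h => hP ?_
    rw [← (Finset.mem_filter.1 hT).2.1]
    exact hC.pull_mem _ h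
  comul_mem := by
    refine complSpan_le (S := Submodule.comap (posOps K).comul
      (LinearMap.range (TensorProduct.map (complSpan K C).subtype LinearMap.id) ⊔
        LinearMap.range (TensorProduct.map LinearMap.id (complSpan K C).subtype))) fun n T hT => ?_
    rw [Submodule.mem_comap, comul_F]
    refine Submodule.sum_mem _ fun X hX => ?_
    by_cases h1 : pull T (X.orderEmbOfFin rfl) ∈ C _
    · have h2 : pull T (Xᶜ.orderEmbOfFin rfl) ∉ C _ := fun h2 =>
        hT (hC.mem_of_isCut (Finset.mem_filter.1 hX).2 h1 h2)
      exact Submodule.mem_sup_right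
        ⟨part K T X ⊗ₜ ⟨part K T Xᶜ, F_mem_complSpan h2⟩, by simp⟩
    · exact Submodule.mem_sup_left
        ⟨⟨part K T X, F_mem_complSpan h1⟩ ⊗ₜ part K T Xᶜ, by simp⟩
  counit_eq_zero := by
    refine complSpan_le (S := LinearMap.ker (posOps K).counit) fun n T hT => ?_
    rw [LinearMap.mem_ker, counit_F, if_neg]
    rintro rfl
    exact hT (Subsingleton.elim emptyPos T ▸ hC.empty_mem)

theorem IsClosedFamily.antipode_mem (hC : IsClosedFamily C) :
    ∀ x ∈ complSpan K C, antipode K x ∈ complSpan K C := by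
  refine complSpan_le (S := (complSpan K C).comap (antipode K)) fun n T hT => ?_
  rw [Submodule.mem_comap, antipode_F]
  exact Submodule.sum_mem _ fun k _ => hC.isBiideal.convPow_mem k _ (F_mem_complSpan hT)

theorem FQuo_eq_zero {n : ℕ} {P : IPos n} (hP : P ∉ C n) : FQuo K C P = 0 :=
  (Submodule.Quotient.mk_eq_zero _).2 (F_mem_complSpan hP)

variable (K C)

/-- The coordinates on the quotient by the posets which are not in `C`. -/
def quotientCoord : (KIPos K ⧸ complSpan K C) →ₗ[K] (Σ n, C n) →₀ K :=
  (complSpan K C).liftQ (Finsupp.lift ((Σ n, C n) →₀ K) K (Σ n, IPos n) fun T =>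
    if h : T.2 ∈ C T.1 then Finsupp.single ⟨T.1, T.2, h⟩ 1 else 0)
    (complSpan_le fun n P hP => by simp [F, hP])

theorem quotientCoord_FQuo {n : ℕ} (P : C n) :
    quotientCoord K C (FQuo K C P.1) = Finsupp.single ⟨n, P⟩ 1 := by
  simp [quotientCoord, FQuo, F]

/-- Independence comes from `quotientCoord`, which sends these classes to the standard basis; they
span because all other classes vanish. -/
theorem exists_basis_FQuo : ∃ b : Module.Basis (Σ n, C n) K (KIPos K ⧸ complSpan K C),
    ∀ (n : ℕ) (P : C n), b ⟨n, P⟩ = FQuo K C P.1 := by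
  have hli : LinearIndependent K fun x : Σ n, C n => FQuo K C x.2.1 := by
    refine LinearIndependent.of_comp (quotientCoord K C) ?_
    have : quotientCoord K C ∘ (fun x : Σ n, C n => FQuo K C x.2.1) =
        fun x => Finsupp.single x 1 := funext fun x => quotientCoord_FQuo K C x.2
    rw [this]
    exact Finsupp.linearIndependent_single_one K _
  have hsp : ⊤ ≤ Submodule.span K (Set.range fun x : Σ n, C n => FQuo K C x.2.1) := by
    rintro x -
    obtain ⟨x, rfl⟩ := (complSpan K C).mkQ_surjective x
    induction x using KIPos_induction with
    | h0 => simp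
    | hadd x y hx hy => rw [map_add]; exact Submodule.add_mem _ hx hy
    | hsmul c x hx => rw [map_smul]; exact Submodule.smul_mem _ c hx
    | hF n P =>
    by_cases hP : P ∈ C n
    · exact Submodule.subset_span ⟨⟨n, P, hP⟩, rfl⟩
    · change FQuo K C P ∈ _
      rw [FQuo_eq_zero hP]
      exact Submodule.zero_mem _
  exact ⟨Module.Basis.mk hli hsp, fun n P => Module.Basis.mk_apply hli hsp _⟩

/-! ### The shifted shuffle as an interval of the weak order -/

section Block

variable {m n : ℕ} (R : IRel m) (S : IRel n) (I : Fin m → Fin n → Prop) (D : Fin n → Fin m → Prop)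

@[simp] theorem block_castAdd_castAdd (i j : Fin m) :
    (block R S I D).1 (Fin.castAdd n i) (Fin.castAdd n j) ↔ R.1 i j := by
  simp [block]

@[simp] theorem block_castAdd_natAdd (i : Fin m) (j : Fin n) :
    (block R S I D).1 (Fin.castAdd n i) (Fin.natAdd m j) ↔ I i j := by
  simp [block]

@[simp] theorem block_natAdd_castAdd (i : Fin n) (j : Fin m) :
    (block R S I D).1 (Fin.natAdd m i) (Fin.castAdd n j) ↔ D i j := by
  simp [block]

@[simp] theorem block_natAdd_natAdd (i j : Fin n) :
    (block R S I D).1 (Fin.natAdd m i) (Fin.natAdd m j) ↔ S.1 i j := by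
  simp [block]

end Block

theorem block_mem_convolution {m n : ℕ} (P : IPos m) (Q : IPos n) :
    underProd P.1 Q.1 ∈ convolution (m + n) P.1 Q.1 ∧
      overProd P.1 Q.1 ∈ convolution (m + n) Q.1 P.1 := by
  set X := shiftedUnion (Finset.univ : Finset (Fin m)) (∅ : Finset (Fin n)) with hXdef
  have hXc : Xᶜ = shiftedUnion ∅ Finset.univ := by simp [X, compl_shiftedUnion]
  have hXcard : X.card = m := by
    have : X = Finset.univ.map (Fin.castAddEmb n) := finset_fin_add_ext (by simp [X])
      (by simp [X, Fin.ext_iff]; omega)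
    simp [this]
  have hYcard : Xᶜ.card = n := by
    rw [Finset.card_compl, hXcard, Fintype.card_fin, Nat.add_sub_cancel_left]
  have hX : X.orderEmbOfFin hXcard = Fin.castAddOrderEmb n :=
    (Finset.orderEmbOfFin_unique' hXcard fun i => castAdd_mem_shiftedUnion.2 (by simp)).symm
  have hY : Xᶜ.orderEmbOfFin hYcard = Fin.natAddOrderEmb m :=
    (Finset.orderEmbOfFin_unique' hYcard fun i => by
      rw [hXc]; exact natAdd_mem_shiftedUnion.2 (by simp)).symm
  constructor
  · refine ⟨X, Xᶜ, hXcard, hYcard, ⟨isCompl_compl, ?_⟩, ?_, ?_⟩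
    · intro x hx y hy
      rw [hXc] at hy
      induction x using Fin.addCases <;> induction y using Fin.addCases <;>
        simp_all [X, underProd, block]
    · simp [restrict, hX, underProd, block]
    · simp [restrict, hY, underProd, block]
  · refine ⟨Xᶜ, X, hYcard, hXcard, ⟨isCompl_compl.symm, ?_⟩, ?_, ?_⟩
    · intro y hy x hx
      rw [hXc] at hy
      induction x using Fin.addCases <;> induction y using Fin.addCases <;>
        simp_all [X, overProd, block]
    · simp [restrict, hY, overProd, block]
    · simp [restrict, hX, overProd, block]

/-- Inside a block the two bounds coincide and force equality. Across blocks they are the extreme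
possibilities and impose nothing. -/
theorem mem_shiftedShuffle_iff_weakLE {m n : ℕ} {P : IPos m} {Q : IPos n} {T : IPos (m + n)} :
    T.1 ∈ shiftedShuffle P.1 Q.1 ↔
      WeakLE (underProd P.1 Q.1) T.1 ∧ WeakLE T.1 (overProd P.1 Q.1) := by
  rw [mem_shiftedShuffle_iff]
  constructor
  · rintro ⟨rfl, rfl⟩
    constructor <;> constructor <;> intro a b hab <;>
      induction a using Fin.addCases <;> induction b using Fin.addCases <;>
      simp only [underProd, overProd, block_castAdd_castAdd, block_castAdd_natAdd,
        block_natAdd_castAdd, block_natAdd_natAdd] <;>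
      first
      | exact id
      | exact fun h => h.elim
      | exact fun _ => trivial
      | simp only [Fin.le_def, Fin.val_castAdd, Fin.val_natAdd] at hab; omega
  · rintro ⟨⟨h1, h2⟩, h3, h4⟩
    constructor <;> refine ipos_ext fun i j => ?_
    · rcases le_total i j with h | h
      · exact ⟨fun ht => (block_castAdd_castAdd ..).1 (h1 _ _ h ht),
          fun hp => h3 _ _ h ((block_castAdd_castAdd ..).2 hp)⟩
      · exact ⟨fun ht => (block_castAdd_castAdd ..).1 (h4 _ _ h ht),
          fun hp => h2 _ _ h ((block_castAdd_castAdd ..).2 hp)⟩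
    · rcases le_total i j with h | h
      · have h := (Fin.natAddOrderEmb m).le_iff_le.2 h
        exact ⟨fun ht => (block_natAdd_natAdd ..).1 (h1 _ _ h ht),
          fun hp => h3 _ _ h ((block_natAdd_natAdd ..).2 hp)⟩
      · have h := (Fin.natAddOrderEmb m).le_iff_le.2 h
        exact ⟨fun ht => (block_natAdd_natAdd ..).1 (h4 _ _ h ht),
          fun hp => h2 _ _ h ((block_natAdd_natAdd ..).2 hp)⟩

variable {C}

theorem mkQ_mul_F_F {m n : ℕ} (P : IPos m) (Q : IPos n) :
    (complSpan K C).mkQ ((posOps K).mul (F K P) (F K Q)) =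
      ∑ T : IPos (m + n) with T ∈ C (m + n) ∧ WeakLE (underProd P.1 Q.1) T.1 ∧
        WeakLE T.1 (overProd P.1 Q.1), FQuo K C T := by
  rw [mul_F K (isConcat_castAdd_natAdd m n), map_sum]
  simp only [← mem_shiftedShuffle_iff, ← mem_shiftedShuffle_iff_weakLE]
  symm
  refine Finset.sum_subset (fun T hT => ?_) fun T hT hT' => FQuo_eq_zero fun h => hT' ?_
  · simp only [Finset.mem_filter, Finset.mem_univ, true_and] at hT ⊢
    exact hT.2
  · simp only [Finset.mem_filter, Finset.mem_univ, true_and] at hT ⊢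
    exact ⟨h, hT⟩

end Family

section Permutations

open Classical

/-! ### Linear extensions and the three families -/

theorem exists_equiv_fin_lt_iff {α : Type*} [Fintype α] {n : ℕ} (h : Fintype.card α = n)
    (r : α → α → Prop) [IsStrictTotalOrder α r] : ∃ e : α ≃ Fin n, ∀ x y, e x < e y ↔ r x y := by
  let := linearOrderOfSTO r
  exact ⟨(Fintype.orderIsoFinOfCardEq α h).symm.toEquiv,
    fun x y => (Fintype.orderIsoFinOfCardEq α h).symm.lt_iff_lt⟩

theorem exists_perm_lt_iff {n : ℕ} (r : Fin n → Fin n → Prop) [IsStrictTotalOrder (Fin n) r] :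
    ∃ τ : Equiv.Perm (Fin n), ∀ u v, τ.symm u < τ.symm v ↔ r u v := by
  obtain ⟨e, he⟩ := exists_equiv_fin_lt_iff (Fintype.card_fin n) r
  exact ⟨e.symm, he⟩

theorem chain_or_lt {n : ℕ} (τ : Equiv.Perm (Fin n)) (u v : Fin n) :
    chain τ u v ∨ τ.symm v < τ.symm u := le_or_gt _ _

theorem not_chain {n : ℕ} {τ : Equiv.Perm (Fin n)} {u v : Fin n} :
    ¬ chain τ u v ↔ τ.symm v < τ.symm u := not_le

/-- Adjoining `v ≺ u` to `P` and closing transitively creates no cycle, and the resulting order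
extends to a total one. -/
theorem exists_isLinExt_lt {n : ℕ} (P : IPos n) {u v : Fin n} (h : ¬ P.1.1 u v) :
    ∃ τ, IsLinExt P τ ∧ τ.symm v < τ.symm u := by
  have hvu : v ≠ u := by
    rintro rfl
    exact h (P.1.2 v)
  let r : Fin n → Fin n → Prop := fun x y => P.1.1 x y ∨ P.1.1 x v ∧ P.1.1 u y
  have htr := P.2.1
  have : IsPartialOrder (Fin n) r :=
    { refl := fun x => Or.inl (P.1.2 x)
      trans := by
        rintro x y z (h1 | ⟨h1, h2⟩) (h3 | ⟨h3, h4⟩)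
        · exact Or.inl (htr _ _ _ h1 h3)
        · exact Or.inr ⟨htr _ _ _ h1 h3, h4⟩
        · exact Or.inr ⟨h1, htr _ _ _ h2 h3⟩
        · exact absurd (htr _ _ _ h2 h3) h
      antisymm := by
        rintro x y (h1 | ⟨h1, h2⟩) (h3 | ⟨h3, h4⟩)
        · exact P.2.2 _ _ h1 h3
        · exact absurd (htr _ _ _ h4 (htr _ _ _ h1 h3)) h
        · exact absurd (htr _ _ _ h2 (htr _ _ _ h3 h1)) h
        · exact absurd (htr _ _ _ h2 h3) h }
  obtain ⟨s, hs, hrs⟩ := extend_partialOrder r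
  have : IsStrictTotalOrder (Fin n) fun x y => s x y ∧ x ≠ y :=
    { trichotomous := fun x y h1 h2 => by
        by_contra hne
        rcases hs.total x y with h' | h'
        · exact h1 ⟨h', hne⟩
        · exact h2 ⟨h', Ne.symm hne⟩
      irrefl := fun x h => h.2 rfl
      trans := fun x y z h1 h2 => ⟨hs.trans _ _ _ h1.1 h2.1, by
        rintro rfl
        exact h1.2 (hs.antisymm _ _ h1.1 h2.1)⟩ }
  obtain ⟨τ, hτ⟩ := exists_perm_lt_iff fun x y => s x y ∧ x ≠ y
  refine ⟨τ, fun x y hxy => ?_, (hτ v u).2 ⟨hrs _ _ (Or.inr ⟨P.1.2 v, P.1.2 u⟩), hvu⟩⟩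
  by_contra hc
  have := (hτ y x).1 (not_chain.1 hc)
  exact this.2 (hs.antisymm _ _ this.1 (hrs _ _ (Or.inl hxy)))

/-- Relations of `P` along `r` factor through the intermediate elements for `r`. -/
def Interpolates {n : ℕ} (r : Fin n → Fin n → Prop) (P : IPos n) : Prop :=
  ∀ a b c, r a b → r b c → P.1.1 a c → P.1.1 a b ∨ P.1.1 b c

/-- `τ` is a linear extension of `P` which reverses all the pairs along `r` which are reversed by
some linear extension. -/
def IsExtremal {n : ℕ} (r : Fin n → Fin n → Prop) (P : IPos n) (τ : Equiv.Perm (Fin n)) : Prop :=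
  IsLinExt P τ ∧ ∀ ρ, IsLinExt P ρ → ∀ a b, r a b → ρ.symm b < ρ.symm a → τ.symm b < τ.symm a

/-- If `P` lacks the relation, some linear extension reverses the pair, hence so does `τ`. -/
theorem IsExtremal.chain_iff {n : ℕ} {r : Fin n → Fin n → Prop} {P : IPos n}
    {τ : Equiv.Perm (Fin n)} (h : IsExtremal r P τ) {a b : Fin n} (hab : r a b) :
    chain τ a b ↔ P.1.1 a b := by
  refine ⟨fun hc => ?_, h.1 a b⟩
  by_contra hP
  obtain ⟨ρ, hρ, hlt⟩ := exists_isLinExt_lt P hP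
  exact not_chain.2 (h.2 ρ hρ a b hab hlt) hc

/-- When `a` precedes `c` in a chain, any `b` comes after `a` or before `c`. -/
theorem interpolates_of_chain_iff {n : ℕ} {r : Fin n → Fin n → Prop} [IsStrictTotalOrder (Fin n) r]
    {P : IPos n} {τ : Equiv.Perm (Fin n)} (h : ∀ a b, r a b → (chain τ a b ↔ P.1.1 a b)) :
    Interpolates r P := by
  intro a b c hab hbc hac
  rw [← h a c (trans_of r hab hbc)] at hac
  rw [← h a b hab, ← h b c hbc]
  rcases chain_or_lt τ a b with h1 | h1
  · exact Or.inl h1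
  · exact Or.inr (h1.le.trans hac)

theorem exists_isExtremal {n : ℕ} {r : Fin n → Fin n → Prop} [IsStrictTotalOrder (Fin n) r]
    {P : IPos n} (h : Interpolates r P) : ∃ τ, IsExtremal r P τ := by
  -- The only possible extremal order: a pair along `r` is reversed exactly when `P` does not relate
  -- it in that direction.
  let L : Fin n → Fin n → Prop := fun u v => r u v ∧ P.1.1 u v ∨ r v u ∧ ¬ P.1.1 v u
  have hasymm : ∀ u v, r u v → ¬ r v u := fun u v h1 h2 => irrefl_of r u (trans_of r h1 h2)
  have htot : ∀ u v, u ≠ v → r u v ∨ r v u := fun u v hne => by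
    rcases trichotomous_of r u v with h1 | h1 | h1
    · exact Or.inl h1
    · exact absurd h1 hne
    · exact Or.inr h1
  have : IsStrictTotalOrder (Fin n) L :=
    { trichotomous := fun u v h1 h2 => by
        by_contra hne
        have := htot u v hne
        simp only [L] at h1 h2
        tauto
      irrefl := fun u hu => by
        have := irrefl_of r u
        simp only [L] at hu
        tauto
      trans := fun u v w h1 h2 => by
        have htr := P.2.1
        have hrt : ∀ x y z, r x y → r y z → r x z := fun x y z => trans_of r
        have hne : u ≠ w := by
          rintro rfl
          have := hasymm u v
          simp only [L] at h1 h2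
          tauto
        rcases htot u w hne with h3 | h3
        · refine Or.inl ⟨h3, ?_⟩
          by_contra hn
          -- Two steps along `r` compose by transitivity of `P`, and two steps against it contradict
          -- `r u w`. The mixed cases are where interpolation is needed.
          rcases h1 with ⟨h1, h1'⟩ | ⟨h1, h1'⟩ <;> rcases h2 with ⟨h2, h2'⟩ | ⟨h2, h2'⟩
          · exact hn (htr _ _ _ h1' h2')
          · exact (h u w v h3 h2 h1').elim hn h2'
          · exact (h v u w h1 h3 h2').elim h1' hn
          · exact hasymm _ _ h3 (hrt _ _ _ h2 h1)
        · refine Or.inr ⟨h3, fun hn => ?_⟩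
          rcases h1 with ⟨h1, h1'⟩ | ⟨h1, h1'⟩ <;> rcases h2 with ⟨h2, h2'⟩ | ⟨h2, h2'⟩
          · exact hasymm _ _ h3 (hrt _ _ _ h1 h2)
          · exact h2' (htr _ _ _ hn h1')
          · exact h1' (htr _ _ _ h2' hn)
          · exact (h w v u h2 h1 hn).elim h2' h1' }
  obtain ⟨τ, hτ⟩ := exists_perm_lt_iff L
  refine ⟨τ, fun u v huv => ?_, fun ρ hρ a b hab hlt => ?_⟩
  · by_contra hc
    rcases (hτ v u).1 (not_chain.1 hc) with ⟨h1, h2⟩ | ⟨h1, h2⟩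
    · exact irrefl_of r u (P.2.2 _ _ huv h2 ▸ h1)
    · exact h2 huv
  · rw [hτ]
    exact Or.inr ⟨hab, fun hP => not_chain.2 hlt (hρ a b hP)⟩

theorem exists_isExtremal_iff {n : ℕ} {r : Fin n → Fin n → Prop} [IsStrictTotalOrder (Fin n) r]
    {P : IPos n} : (∃ τ, IsExtremal r P τ) ↔ Interpolates r P :=
  ⟨fun ⟨_, h⟩ => interpolates_of_chain_iff fun _ _ => h.chain_iff, exists_isExtremal⟩

/-! ### Interpolation criteria for the three families. -/

theorem permLE_iff_lt {n : ℕ} {σ τ : Equiv.Perm (Fin n)} :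
    PermLE σ τ ↔ ∀ a b, a < b → σ.symm b < σ.symm a → τ.symm b < τ.symm a :=
  ⟨fun h a b hab hlt => (@h (a, b) ⟨hab, hlt⟩).2, fun h _ hab => ⟨hab.1, h _ _ hab.1 hab.2⟩⟩

theorem permLE_iff_gt {n : ℕ} {σ τ : Equiv.Perm (Fin n)} :
    PermLE σ τ ↔ ∀ a b, a > b → τ.symm b < τ.symm a → σ.symm b < σ.symm a := by
  rw [permLE_iff_lt, forall_comm]
  refine forall₃_congr fun a b hab => ?_
  rw [← not_imp_not, not_lt, not_lt, (τ.symm.injective.ne hab.ne).le_iff_lt,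
    (σ.symm.injective.ne hab.ne).le_iff_lt]

theorem isExtremal_lt_iff {n : ℕ} {P : IPos n} {τ : Equiv.Perm (Fin n)} :
    IsExtremal (· < ·) P τ ↔ IsLinExt P τ ∧ ∀ ρ, IsLinExt P ρ → PermLE ρ τ := by
  simp only [permLE_iff_lt, IsExtremal]

theorem isExtremal_gt_iff {n : ℕ} {P : IPos n} {τ : Equiv.Perm (Fin n)} :
    IsExtremal (· > ·) P τ ↔ IsLinExt P τ ∧ ∀ ρ, IsLinExt P ρ → PermLE τ ρ := by
  simp only [permLE_iff_gt, IsExtremal]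

theorem mem_IWOIP_iff {n : ℕ} {P : IPos n} : P ∈ IWOIP n ↔ Interpolates (· < ·) P := by
  rw [← exists_isExtremal_iff]
  exact exists_congr fun τ => isExtremal_lt_iff.symm

theorem mem_DWOIP_iff {n : ℕ} {P : IPos n} : P ∈ DWOIP n ↔ Interpolates (· > ·) P := by
  rw [← exists_isExtremal_iff]
  exact exists_congr fun τ => isExtremal_gt_iff.symm

theorem PermLE.chain_of_lt {n : ℕ} {σ τ : Equiv.Perm (Fin n)} (h : PermLE σ τ) {u v : Fin n}
    (huv : u < v) (hc : chain τ u v) : chain σ u v := by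
  by_contra hn
  exact not_chain.2 (permLE_iff_lt.1 h u v huv (not_chain.1 hn)) hc

theorem PermLE.chain_of_gt {n : ℕ} {σ τ : Equiv.Perm (Fin n)} (h : PermLE σ τ) {u v : Fin n}
    (huv : u > v) (hc : chain σ u v) : chain τ u v := by
  by_contra hn
  exact not_chain.2 (permLE_iff_gt.1 h u v huv (not_chain.1 hn)) hc

/-- In the intersection over an interval, the increasing relations are those of its top and the
decreasing ones those of its bottom. Conversely, the interval runs from the minimum to the maximum
linear extension. -/
theorem mem_WOIP_iff {n : ℕ} {P : IPos n} :
    P ∈ WOIP n ↔ Interpolates (· < ·) P ∧ Interpolates (· > ·) P := by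
  constructor
  · rintro ⟨σ, σ', hle, h⟩
    refine ⟨interpolates_of_chain_iff (τ := σ') fun a b hab => ?_,
      interpolates_of_chain_iff (τ := σ) fun a b hab => ?_⟩ <;> rw [h]
    · exact ⟨fun hc τ _ hτ => hτ.chain_of_lt hab hc, fun hc => hc σ' hle subset_rfl⟩
    · exact ⟨fun hc τ hτ _ => hτ.chain_of_gt hab hc, fun hc => hc σ subset_rfl hle⟩
  · rintro ⟨h1, h2⟩
    obtain ⟨τ, hτ⟩ := exists_isExtremal h1
    obtain ⟨σ, hσ⟩ := exists_isExtremal h2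
    have hle : PermLE σ τ := (isExtremal_lt_iff.1 hτ).2 σ hσ.1
    refine ⟨σ, τ, hle, fun u v => ?_⟩
    rcases lt_trichotomy u v with huv | rfl | huv
    · rw [← hτ.chain_iff huv]
      exact ⟨fun hc ρ _ hρ => hρ.chain_of_lt huv hc, fun hc => hc τ hle subset_rfl⟩
    · exact iff_of_true (P.1.2 u) fun _ _ _ => le_rfl
    · rw [← hσ.chain_iff huv]
      exact ⟨fun hc ρ hρ _ => hρ.chain_of_gt huv hc, fun hc => hc σ subset_rfl hle⟩

/-! ### Closure of the three families under restrictions and ordinal sums. -/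

theorem Interpolates.pull {k p : ℕ} {r : Fin p → Fin p → Prop} {s : Fin k → Fin k → Prop}
    {T : IPos p} (h : Interpolates r T) (f : Fin k ↪o Fin p) (hf : ∀ i j, s i j → r (f i) (f j)) :
    Interpolates s (pull T f) :=
  fun a b c hab hbc => h (f a) (f b) (f c) (hf a b hab) (hf b c hbc)

/-- If `a` and `c` lie on different sides of the cut, then `a` is below, and `b` is related to
whichever of them is across from it. If they are on one side and `b` on the other, the cut again
relates `b` to one of them. -/
theorem Interpolates.of_isCut {p : ℕ} {r : Fin p → Fin p → Prop} {T : IPos p} {X : Finset (Fin p)}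
    {s : Fin X.card → Fin X.card → Prop} {t : Fin Xᶜ.card → Fin Xᶜ.card → Prop}
    (hs : ∀ i j, r (X.orderEmbOfFin rfl i) (X.orderEmbOfFin rfl j) → s i j)
    (ht : ∀ i j, r (Xᶜ.orderEmbOfFin rfl i) (Xᶜ.orderEmbOfFin rfl j) → t i j)
    (hT : IsCut T X Xᶜ) (h1 : Interpolates s (IntegerPosets.pull T (X.orderEmbOfFin rfl)))
    (h2 : Interpolates t (IntegerPosets.pull T (Xᶜ.orderEmbOfFin rfl))) : Interpolates r T := by
  intro a b c hab hbc hac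
  by_cases ha : a ∈ X <;> by_cases hb : b ∈ X <;> by_cases hc : c ∈ X
  · obtain ⟨a, rfl⟩ := exists_orderEmbOfFin_eq ha
    obtain ⟨b, rfl⟩ := exists_orderEmbOfFin_eq hb
    obtain ⟨c, rfl⟩ := exists_orderEmbOfFin_eq hc
    exact h1 a b c (hs _ _ hab) (hs _ _ hbc) hac
  · exact Or.inr (hT b hb c (Finset.mem_compl.2 hc))
  · exact Or.inl (hT a ha b (Finset.mem_compl.2 hb))
  · exact Or.inl (hT a ha b (Finset.mem_compl.2 hb))
  · exact absurd hac (((isTotalCut_compl_iff T X).2 hT).2 c hc a (Finset.mem_compl.2 ha)).2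
  · exact Or.inr (hT b hb c (Finset.mem_compl.2 hc))
  · exact absurd hac (((isTotalCut_compl_iff T X).2 hT).2 c hc a (Finset.mem_compl.2 ha)).2
  · obtain ⟨a, rfl⟩ := exists_orderEmbOfFin_eq (Finset.mem_compl.2 ha)
    obtain ⟨b, rfl⟩ := exists_orderEmbOfFin_eq (Finset.mem_compl.2 hb)
    obtain ⟨c, rfl⟩ := exists_orderEmbOfFin_eq (Finset.mem_compl.2 hc)
    exact h2 a b c (ht _ _ hab) (ht _ _ hbc) hac

theorem isClosedFamily_IWOIP : IsClosedFamily IWOIP where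
  empty_mem := mem_IWOIP_iff.2 fun a => a.elim0
  pull_mem f h := mem_IWOIP_iff.2 ((mem_IWOIP_iff.1 h).pull f fun _ _ => f.lt_iff_lt.2)
  mem_of_isCut hT h1 h2 := mem_IWOIP_iff.2 <| .of_isCut (fun _ _ => (OrderEmbedding.lt_iff_lt _).1)
    (fun _ _ => (OrderEmbedding.lt_iff_lt _).1) hT (mem_IWOIP_iff.1 h1) (mem_IWOIP_iff.1 h2)

theorem isClosedFamily_DWOIP : IsClosedFamily DWOIP where
  empty_mem := mem_DWOIP_iff.2 fun a => a.elim0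
  pull_mem f h := mem_DWOIP_iff.2 ((mem_DWOIP_iff.1 h).pull f fun _ _ => f.lt_iff_lt.2)
  mem_of_isCut hT h1 h2 := mem_DWOIP_iff.2 <| .of_isCut (fun _ _ => (OrderEmbedding.lt_iff_lt _).1)
    (fun _ _ => (OrderEmbedding.lt_iff_lt _).1) hT (mem_DWOIP_iff.1 h1) (mem_DWOIP_iff.1 h2)

theorem WOIP_eq_inter : WOIP = fun n => IWOIP n ∩ DWOIP n :=
  funext fun n => Set.ext fun P => by
    rw [mem_WOIP_iff, Set.mem_inter_iff, mem_IWOIP_iff, mem_DWOIP_iff]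

theorem IsClosedFamily.inter {C D : ∀ n, Set (IPos n)} (hC : IsClosedFamily C)
    (hD : IsClosedFamily D) : IsClosedFamily fun n => C n ∩ D n where
  empty_mem := ⟨hC.empty_mem, hD.empty_mem⟩
  pull_mem f h := ⟨hC.pull_mem f h.1, hD.pull_mem f h.2⟩
  mem_of_isCut hT h1 h2 := ⟨hC.mem_of_isCut hT h1.1 h2.1, hD.mem_of_isCut hT h1.2 h2.2⟩

theorem isClosedFamily_WOIP : IsClosedFamily WOIP :=
  WOIP_eq_inter ▸ isClosedFamily_IWOIP.inter isClosedFamily_DWOIP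

end Permutations

end IntegerPosets

end

/-! ### Assembly of the proposition. -/

open IntegerPosets Classical in
theorem mainTheorem4 (K : Type*) [Field K] :
    ∃ S : KIPos K →ₗ[K] KIPos K,
      -- the integer poset algebra is a Hopf algebra, with antipode `S`
      (posOps K).IsHopfAlgebra S ∧
      ∀ C ∈ ({WOIP, IWOIP, DWOIP} : Set (∀ n, Set (IPos n))),
        -- (i) shifted shuffle
        (∀ (m n : ℕ) (P : IPos m) (Q : IPos n),
          (∃ T : IPos (m + n), T.1 ∈ shiftedShuffle P.1 Q.1 ∧ T ∈ C (m + n)) →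
            P ∈ C m ∧ Q ∈ C n) ∧
        -- (ii) convolution
        (∀ (m n : ℕ) (P : IPos m) (Q : IPos n), P ∈ C m → Q ∈ C n →
          ∀ T ∈ convolution (m + n) P.1 Q.1, ∃ hT : T.IsPoset, (⟨T, hT⟩ : IPos (m + n)) ∈ C (m + n)) ∧
        -- the posets which are not in `C` span a Hopf ideal
        (posOps K).IsHopfIdeal S (complSpan K C) ∧
        -- the quotient is a Hopf algebra, with the operations induced by those of `KIPos K`
        ∃ (O : Ops K (KIPos K ⧸ complSpan K C))
          (S₂ : (KIPos K ⧸ complSpan K C) →ₗ[K] (KIPos K ⧸ complSpan K C)),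
          O.IsHopfAlgebra S₂ ∧
          (posOps K).IsHom O (complSpan K C).mkQ ∧
          (∀ x, S₂ ((complSpan K C).mkQ x) = (complSpan K C).mkQ (S x)) ∧
          -- the classes of the posets in `C` form a basis of it
          (∃ b : Module.Basis (Σ n, C n) K (KIPos K ⧸ complSpan K C),
            ∀ (n : ℕ) (P : C n), b ⟨n, P⟩ = FQuo K C P.1) ∧
          -- its product is a sum over an interval of the weak order on `C (m + n)`
          (∀ (m n : ℕ) (P : IPos m) (Q : IPos n), P ∈ C m → Q ∈ C n →
            (∃ U ∈ C (m + n), U.1 = underProd P.1 Q.1) ∧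
            (∃ U ∈ C (m + n), U.1 = overProd P.1 Q.1) ∧
            O.mul (FQuo K C P) (FQuo K C Q) =
              ∑ T : IPos (m + n) with T ∈ C (m + n) ∧
                WeakLE (underProd P.1 Q.1) T.1 ∧ WeakLE T.1 (overProd P.1 Q.1), FQuo K C T) := by
  refine ⟨antipode K, isBialgebra_posOps.isHopfAlgebra conv_antipode.1 conv_antipode.2, ?_⟩
  intro C hmem
  have hC : IsClosedFamily C := by
    rcases hmem with rfl | rfl | rfl
    exacts [isClosedFamily_WOIP, isClosedFamily_IWOIP, isClosedFamily_DWOIP]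
  have hI := hC.isBiideal (K := K)
  refine ⟨fun m n P Q ⟨T, hT, h⟩ => hC.mem_of_shiftedShuffle hT h,
    fun m n P Q hP hQ T hT => hC.mem_of_convolution hP hQ hT, hI.isHopfIdeal hC.antipode_mem,
    hI.quotientOps, (complSpan K C).mapQ _ _ hC.antipode_mem,
    hI.isHopfAlgebra_quotientOps isBialgebra_posOps conv_antipode.1 conv_antipode.2 hC.antipode_mem,
    hI.isHom_mkQ, fun _ => rfl, exists_basis_FQuo K C, fun m n P Q hP hQ => ⟨?_, ?_, ?_⟩⟩
  · obtain ⟨h, hmem⟩ := hC.mem_of_convolution hP hQ (block_mem_convolution P Q).1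
    exact ⟨_, hmem, rfl⟩
  -- In `overProd` the shifted block lies below, so it belongs to the convolution of `Q` with `P`,
  -- taken on `m + n` points.
  · obtain ⟨h, hmem⟩ := hC.mem_of_convolution hQ hP (block_mem_convolution P Q).2
    exact ⟨_, hmem, rfl⟩
  · rw [← mkQ_mul_F_F]
    rfl
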